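/- **Theorem 6.1.** Let $n\ge s\ge 1$ and let $X=(x_i^j)$ be a real $s\times(n+1)$ matrix with columns $x^0,\dots,x^n\in\mathbb R^s$ whose convex hull $[X]$ has positive $s$-dimensional volume. Let $d\in\mathbb R^{n+1}$ have positive components and let $h$ be a continuous complex-valued function on $I=[\min x_i^j,\max x_i^j]$. For $\beta=(\beta_0,\dots,\beta_m)$ with positive components, let $$\phi_\beta(t)=\Gamma(\beta_0+\cdots+\beta_m)\prod_{i=0}^m\frac{t_i^{\beta_i-1}}{\Gamma(\beta_i)},\qquad t_0=1-t_1-\cdots-t_m,$$ be the Dirichlet density on $E_m=\{t\in\mathbb R^m: t_j\ge0,\ \sum_{j=1}^m t_j\le1\}$. The Dirichlet spline $M(\cdot|d;X)$ is the locally integrable function on $\mathbb R^s$, unique up to a null set, with $$\int_{\mathbb R^s}f(x)M(x|d;X)\,dx=\int_{E_n}f\Big(\sum_{j=0}^n t_jx^j\Big)\phi_d(t)\,dt$$ for all continuous $f:\mathbb R^s\to\mathbb R$ with compact support. For $b=(b_1,\dots,b_s)$ with positive components and $x\in[X]$ let $$H(b;x)=\int_{E_{s-1}}h\Big(\sum_{i=1}^s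 u_ix_i\Big)\phi_b(u)\,du,\qquad \mathcal H(b;X;d)=\int_{E_n}\int_{E_{s-1}}h\Big(\sum_{i=1}^s\sum_{j=0}^n u_ix_i^jv_j\Big)\phi_b(u)\phi_d(v)\,du\,dv,$$ where $u_1=1-u_2-\cdots-u_s$, $v_0=1-v_1-\cdots-v_n$, $du=du_2\cdots du_s$, $dv=dv_1\cdots dv_n$. Then $M(\cdot|d;X)$ exists, and the identity $$\mathcal H(b;X;d)=\int_{[X]}M(x|d;X)\,H(b;x)\,dx\tag{$*$}$$ holds, with an integrable integrand, in each of the following cases. 1. $b\in\mathbb R^s$ has positive components. 2. $b\in V$, where $V\subseteq\mathbb C^s$ is any connected open set that contains all real vectors with positive components and to which the functions $H(\cdot\,;x)$, $x\in[X]$, continue analytically in $b$ with $H(b;x)$ continuous in $(b,x)\in V\times[X]$. In this case $\mathcal H(\cdot\,;X;d)$ continues analytically to $V$, and both sides of $(*)$ denote the continued functions. 3. $h$ is infinitely differentiable on $I$, and $b\in\mathbb C^s$ (in particular $b\in\mathbb R^s$) satisfies $c=b_1+\cdots+b_s\ne0,-1,-2,\dots$. In this case $H(\cdot\,;x)$,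 for every $x\in[X]$, and $\mathcal H(\cdot\,;X;d)$ continue analytically to the set of all such $b\in\mathbb C^s$, and both sides of $(*)$ denote the continued functions. -/

import Mathlib

open MeasureTheory Set
open scoped ContDiff

noncomputable section

/-- The standard simplex `E_m = {t ∈ ℝ^m : t_j ≥ 0, ∑ t_j ≤ 1}`. -/
def stdSimplexE (m : ℕ) : Set (Fin m → ℝ) :=
  {t | (∀ j, 0 ≤ t j) ∧ ∑ j, t j ≤ 1}

/-- The barycentric weights `(1 - t_1 - ⋯ - t_m, t_1, …, t_m)` of a point `t ∈ E_m`. -/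
def baryWeights {m : ℕ} (t : Fin m → ℝ) : Fin (m + 1) → ℝ :=
  Fin.cons (1 - ∑ j, t j) t

/-- The Dirichlet density `φ_b(t) = Γ(c) ∏ Γ(b_i)⁻¹ t_i ^ (b_i - 1)` on `E_m`, where
`c = ∑ b_i` and `t_0 = 1 - t_1 - ⋯ - t_m`, for a real parameter vector `b`. -/
def dirichletDensity {m : ℕ} (b : Fin (m + 1) → ℝ) (t : Fin m → ℝ) : ℝ :=
  Real.Gamma (∑ i, b i) *
    ∏ i, (Real.Gamma (b i))⁻¹ * baryWeights t i ^ (b i - 1)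

/-- `M` is (a version of) the multivariate Dirichlet spline `M(· | d; X)`: the locally integrable
function, unique up to a null set, with `∫ f(x) M(x) dx = ∫_{E_n} f(Xt) φ_d(t) dt` for every
continuous `f` with compact support. Here `Xt = ∑ t_j x^j`, and `X j` is the point `x^j`. -/
def IsDirichletSpline {n s : ℕ} (d : Fin (n + 1) → ℝ) (X : Fin (n + 1) → Fin s → ℝ)
    (M : (Fin s → ℝ) → ℝ) : Prop :=
  LocallyIntegrable M volume ∧
    ∀ f : (Fin s → ℝ) → ℝ, Continuous f → HasCompactSupport f →
      ∫ x, f x * M x =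
        ∫ t in stdSimplexE n, f (∑ j, baryWeights t j • X j) * dirichletDensity d t

/-- The single Dirichlet average `H(b; z) = ∫_{E_m} h(∑ u_i z_i) φ_b(u) du` of `h`,
used for `b` with positive components. -/
def dirichletAverage {m : ℕ} (h : ℝ → ℂ) (b : Fin (m + 1) → ℝ) (z : Fin (m + 1) → ℝ) : ℂ :=
  ∫ u in stdSimplexE m, h (∑ i, baryWeights u i * z i) * (dirichletDensity b u : ℂ)

/-- The double Dirichlet average
`ℋ(b; X; d) = ∫_{E_n} ∫_{E_{s-1}} h(u · Xv) φ_b(u) φ_d(v) du dv` of `h`, with `s = r + 1`,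
used for `b` and `d` with positive components. -/
def doubleDirichletAverage {n r : ℕ} (h : ℝ → ℂ) (b : Fin (r + 1) → ℝ)
    (X : Fin (n + 1) → Fin (r + 1) → ℝ) (d : Fin (n + 1) → ℝ) : ℂ :=
  ∫ v in stdSimplexE n, ∫ u in stdSimplexE r,
    h (∑ i, ∑ j, baryWeights u i * X j i * baryWeights v j) *
      (dirichletDensity b u : ℂ) * (dirichletDensity d v : ℂ)

/-- The interval `I = [min x_i^j, max x_i^j]` spanned by the entries of the matrix `X`. -/
def entryInterval {n r : ℕ} (X : Fin (n + 1) → Fin (r + 1) → ℝ) : Set ℝ :=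
  Icc (⨅ j, ⨅ i, X j i) (⨆ j, ⨆ i, X j i)

/-- The complex parameter vectors `b` with `c = ∑ b_i ≠ 0, -1, -2, …`. -/
def regularParams (s : ℕ) : Set (Fin s → ℂ) :=
  {b | ∀ k : ℕ, ∑ i, b i ≠ -(k : ℂ)}

/-- A region of continuation: a connected open set of complex parameter vectors which contains
all real vectors with positive components. -/
def IsContinuationRegion {s : ℕ} (V : Set (Fin s → ℂ)) : Prop :=
  IsOpen V ∧ IsPreconnected V ∧
    ∀ b : Fin s → ℝ, (∀ i, 0 < b i) → (fun i => (b i : ℂ)) ∈ V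

/-- `F` is the analytic continuation to `V` of the function `F₀` of real vectors with positive
components: `F` is holomorphic on `V` and agrees with `F₀` at those vectors. -/
def IsAnalyticContinuation {s : ℕ} (V : Set (Fin s → ℂ)) (F₀ : (Fin s → ℝ) → ℂ)
    (F : (Fin s → ℂ) → ℂ) : Prop :=
  DifferentiableOn ℂ F V ∧
    ∀ b : Fin s → ℝ, (∀ i, 0 < b i) → F (fun i => (b i : ℂ)) = F₀ b

end

/-! The affine map v ↦ Xv sends E_n into [X], and the argument of h in the double average is ∑ u_i
(Xv)_i. The inner integral is therefore H(b; Xv), and (∗) says that M is the density of the image of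
the Dirichlet law under this map. Positive volume makes the linear part of the map surjective, so
the image law is absolutely continuous. Its Radon–Nikodym derivative is a spline
(`isDirichletSpline_rnDeriv`), every other spline equals it almost everywhere, and
`IsDirichletSpline.setIntegral_mul` extends the defining identity to functions that are continuous
only on [X]. This settles positive b.

For complex b, joint continuity of H on the product with the compact hull gives a local majorant, so
the right side of (∗) is holomorphic (`differentiableOn_integral_of_dominated`). It continues the
double average, and continuations are unique by the identity theorem from real points
(`eqOn_of_eventually_eq_real`).

For smooth h the continuation has to be constructed. Let R_h(b) be the average divided by Γ(c), and
e_i the unit vectors. Since ∑ u_i = 1, R_h(b) = ∑ b_i R_h(b + e_i); integration by parts gives R_h(b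
+ e_i) − R_h(b + e_k) = (z_i − z_k) R_{h'}(b + e_i + e_k). Together these express R_h(b) through
averages with b_k raised, at the price of one derivative of h (`reducedAverage_recurrence`). Every
use moves the domain one unit further in the direction k; the results glue to functions entire in b
and jointly continuous in (b, z) (`exists_isJointContinuation_univ`). Only the factor Γ(c) has
poles, and the previous case applies. -/

open Filter Topology

/-! ### Holomorphic parameter integrals, the identity theorem, regions of continuation -/

/-- The difference quotients along `v` with steps `1 / (k + 1)` converge to the derivative. -/
theorem HasFDerivAt.tendsto_nat_quotient {E : Type*} [NormedAddCommGroup E] [NormedSpace ℂ E]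
    {f : E → ℂ} {f' : E →L[ℂ] ℂ} {x : E} (hf : HasFDerivAt f f' x) (v : E) :
    Tendsto (fun k : ℕ => ((k : ℂ) + 1) * (f (x + ((k : ℂ) + 1)⁻¹ • v) - f x)) atTop
      (𝓝 (f' v)) := by
  have hc : Tendsto (fun k : ℕ => ‖((k : ℂ) + 1)‖) atTop atTop := by
    have : ∀ k : ℕ, ‖((k : ℂ) + 1)‖ = (k : ℝ) + 1 := fun k => by
      rw [← Nat.cast_add_one, Complex.norm_natCast]; push_cast; ring
    simp only [this]
    exact tendsto_atTop_add_const_right _ _ tendsto_natCast_atTop_atTop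
  have := hf.lim v hc
  simpa [smul_eq_mul] using this

/-- Holomorphy of integrals which depend holomorphically on a parameter and are locally
dominated. -/
theorem differentiableOn_integral_of_dominated {ι α : Type*} [Fintype ι] [DecidableEq ι]
    [MeasurableSpace α] {μ : Measure α} {V : Set (ι → ℂ)} (hV : IsOpen V)
    {K : (ι → ℂ) → α → ℂ} (hmeas : ∀ b ∈ V, AEStronglyMeasurable (K b) μ)
    (hdiff : ∀ᵐ t ∂μ, DifferentiableOn ℂ (fun b => K b t) V)
    (hbound : ∀ b₀ ∈ V, ∃ ε > 0, ∃ g : α → ℝ, Integrable g μ ∧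
      ∀ᵐ t ∂μ, ∀ b ∈ Metric.ball b₀ ε, ‖K b t‖ ≤ g t) :
    DifferentiableOn ℂ (fun b => ∫ t, K b t ∂μ) V := by
  intro b₀ hb₀
  obtain ⟨ε₁, hε₁, g, hg, hKg⟩ := hbound b₀ hb₀
  obtain ⟨ε₂, hε₂, hball⟩ := Metric.isOpen_iff.1 hV b₀ hb₀
  -- Half the radius: each point of the ε-ball keeps an ε-ball around it on which both holomorphy
  -- and the majorant are available.
  obtain ⟨ε, hε, hεε₁, hεε₂⟩ : ∃ ε > 0, 2 * ε ≤ ε₁ ∧ 2 * ε ≤ ε₂ :=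
    ⟨min ε₁ ε₂ / 2, by positivity, by linarith [min_le_left ε₁ ε₂],
      by linarith [min_le_right ε₁ ε₂]⟩
  have hsub : ∀ x ∈ Metric.ball b₀ ε, Metric.ball x ε ⊆ Metric.ball b₀ (2 * ε) := fun x hx =>
    Metric.ball_subset_ball' (by rw [Metric.mem_ball] at hx; linarith)
  have hinV : Metric.ball b₀ (2 * ε) ⊆ V := (Metric.ball_subset_ball hεε₂).trans hball
  have hin₁ : Metric.ball b₀ (2 * ε) ⊆ Metric.ball b₀ ε₁ := Metric.ball_subset_ball hεε₁
  have hself : Metric.ball b₀ ε ⊆ Metric.ball b₀ (2 * ε) :=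
    Metric.ball_subset_ball (by linarith)
  have hb₀ε : b₀ ∈ Metric.ball b₀ (2 * ε) := Metric.mem_ball_self (by linarith)
  refine (hasFDerivAt_integral_of_dominated_of_fderiv_le (𝕜 := ℂ)
    (F' := fun b t => fderiv ℂ (fun b => K b t) b)
    (bound := fun t => 2 * g t / ε) (Metric.ball_mem_nhds b₀ hε)
    ?_ ?_ ?_ ?_ ?_ ?_).differentiableAt.differentiableWithinAt
  · filter_upwards [hV.mem_nhds hb₀] with b hb using hmeas b hb
  · exact hg.mono' (hmeas b₀ hb₀) (hKg.mono fun t ht => ht b₀ (hin₁ hb₀ε))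
  -- The derivative is measurable in t because each directional derivative is a limit of measurable
  -- difference quotients, and finitely many directions determine it. The shift by `k₀` keeps the
  -- quotients inside V.
  · have hcoord : ∀ v : ι → ℂ,
        AEStronglyMeasurable (fun t => fderiv ℂ (fun b => K b t) b₀ v) μ := by
      intro v
      have hlim : Tendsto (fun k : ℕ => b₀ + ((k : ℂ) + 1)⁻¹ • v) atTop (𝓝 b₀) := by
        have h0 : Tendsto (fun k : ℕ => ((k : ℂ) + 1)⁻¹) atTop (𝓝 0) := by
          simpa [one_div] using tendsto_one_div_add_atTop_nhds_zero_nat (𝕜 := ℂ)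
        simpa using tendsto_const_nhds.add (h0.smul_const v)
      obtain ⟨k₀, hk₀⟩ := eventually_atTop.1 (hlim.eventually (hV.mem_nhds hb₀))
      refine aestronglyMeasurable_of_tendsto_ae (u := atTop)
        (f := fun k t => (((k + k₀ : ℕ) : ℂ) + 1) *
          (K (b₀ + (((k + k₀ : ℕ) : ℂ) + 1)⁻¹ • v) t - K b₀ t)) (fun k => ?_) ?_
      · exact ((hmeas _ (hk₀ _ (Nat.le_add_left _ _))).sub (hmeas b₀ hb₀)).const_mul _
      · filter_upwards [hdiff] with t ht
        exact (((ht.differentiableAt (hV.mem_nhds hb₀)).hasFDerivAt.tendsto_nat_quotient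
          v).comp (tendsto_add_atTop_nat k₀))
    have hsum : (fun t => fderiv ℂ (fun b => K b t) b₀) = fun t => ∑ i,
        (fderiv ℂ (fun b => K b t) b₀ (Pi.single i 1)) •
          (ContinuousLinearMap.proj (R := ℂ) (φ := fun _ : ι => ℂ) i) := by
      ext t v
      have hv : v = ∑ i, v i • (Pi.single i (1 : ℂ) : ι → ℂ) := by
        ext j; simp [Finset.sum_apply, Pi.single_apply]
      conv_lhs => rw [hv]
      simp [map_sum, mul_comm]
    rw [hsum]
    exact Finset.aestronglyMeasurable_fun_sum _ fun i _ => (hcoord _).smul_const _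
  -- Cauchy's estimate on the ε-ball around x, where K(·, t) differs from its value at x by at most
  -- 2 g(t).
  · filter_upwards [hdiff, hKg] with t ht hgt x hx
    have hd : DifferentiableOn ℂ (fun b => K b t) (Metric.ball x ε) :=
      ht.mono ((hsub x hx).trans hinV)
    refine Complex.norm_fderiv_le_div_of_mapsTo_ball (R₂ := 2 * g t) hd ?_ hε
    · intro y hy
      rw [Metric.mem_closedBall, dist_eq_norm]
      have h1 := hgt y (hin₁ (hsub x hx hy))
      have h2 := hgt x (hin₁ (hself hx))
      have h3 := norm_sub_le (K y t) (K x t)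
      linarith
  · exact (hg.const_mul 2).div_const ε
  · filter_upwards [hdiff] with t ht x hx
    exact (ht.differentiableAt (hV.mem_nhds (hinV (hself hx)))).hasFDerivAt

/-- A holomorphic function on a convex open set which vanishes near `w` on a real line through
`w`, in the direction of `v`, vanishes at `w + z • v`. -/
theorem DifferentiableOn.eq_zero_of_eventually_line {E : Type*} [NormedAddCommGroup E]
    [NormedSpace ℂ E] {B : Set E} (hB : IsOpen B) (hc : Convex ℝ B) {f : E → ℂ}
    (hf : DifferentiableOn ℂ f B) {w v : E} (hw : w ∈ B)
    (hz : ∀ᶠ t : ℝ in 𝓝 0, f (w + (t : ℂ) • v) = 0) {z : ℂ} (hzB : w + z • v ∈ B) :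
    f (w + z • v) = 0 := by
  have hcont : Continuous fun z : ℂ => w + z • v := by fun_prop
  have hU : IsOpen ((fun z : ℂ => w + z • v) ⁻¹' B) := hB.preimage hcont
  have hUc : Convex ℝ ((fun z : ℂ => w + z • v) ⁻¹' B) := by
    intro x hx y hy a b ha hb hab
    have : w + (a • x + b • y) • v = a • (w + x • v) + b • (w + y • v) := by
      have : w = (a + b) • w := by rw [hab, one_smul]
      nth_rw 1 [this]
      simp only [add_smul, smul_add, smul_assoc]
      abel
    show w + (a • x + b • y) • v ∈ B
    rw [this]
    exact hc hx hy ha hb hab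
  have hd : DifferentiableOn ℂ (fun z : ℂ => f (w + z • v))
      ((fun z : ℂ => w + z • v) ⁻¹' B) :=
    hf.comp (by fun_prop) fun z hz => hz
  have h0 : (0 : ℂ) ∈ (fun z : ℂ => w + z • v) ⁻¹' B := by simpa using hw
  refine (hd.analyticOnNhd hU).eqOn_zero_of_preconnected_of_frequently_eq_zero
    hUc.isPreconnected h0 ?_ hzB
  have h1 : ∃ᶠ t : ℝ in 𝓝[≠] 0, f (w + (t : ℂ) • v) = 0 :=
    (hz.filter_mono nhdsWithin_le_nhds).frequently
  refine Tendsto.frequently (f := fun t : ℝ => (t : ℂ)) ?_ h1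
  refine tendsto_nhdsWithin_iff.2 ⟨?_, ?_⟩
  · exact (Complex.continuous_ofReal.tendsto' 0 0 (by simp)).mono_left nhdsWithin_le_nhds
  · filter_upwards [self_mem_nhdsWithin] with t ht
    simpa using ht

/-- Identity theorem: holomorphic functions on a connected open set of `ℂ^s` which agree at the
real points near one real point are equal. -/
theorem eqOn_of_eventually_eq_real {ι : Type*} [Fintype ι] {V : Set (ι → ℂ)} (hV : IsOpen V)
    (hVc : IsPreconnected V) {f g : (ι → ℂ) → ℂ} (hf : DifferentiableOn ℂ f V)
    (hg : DifferentiableOn ℂ g V) {b₀ : ι → ℝ} (hb₀ : (fun i => (b₀ i : ℂ)) ∈ V)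
    (hfg : ∀ᶠ b : ι → ℝ in 𝓝 b₀, f (fun i => (b i : ℂ)) = g fun i => (b i : ℂ)) :
    EqOn f g V := by
  set F : (ι → ℂ) → ℂ := fun b => f b - g b with hF
  have hFd : DifferentiableOn ℂ F V := hf.sub hg
  -- By connectedness it is enough that this open set is nonempty and closed relative to V.
  set W : Set (ι → ℂ) := interior {b | F b = 0} with hW
  suffices h : V ⊆ W from fun b hb => sub_eq_zero.1 (show b ∈ {b | F b = 0} from interior_subset (h hb))
  refine hVc.subset_of_closure_inter_subset isOpen_interior ⟨_, hb₀, ?_⟩ ?_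
  · obtain ⟨ε₁, hε₁, hball⟩ := Metric.isOpen_iff.1 hV _ hb₀
    obtain ⟨ε₂, hε₂, hreal⟩ := Metric.eventually_nhds_iff_ball.1 hfg
    rw [hW, mem_interior_iff_mem_nhds]
    filter_upwards [Metric.ball_mem_nhds _ (lt_min hε₁ hε₂)] with b hb
    have hre : (fun i => (b i).re) ∈ Metric.ball b₀ (min ε₁ ε₂) := by
      rw [Metric.mem_ball, dist_pi_lt_iff (lt_min hε₁ hε₂)] at hb ⊢
      intro i
      refine lt_of_le_of_lt ?_ (hb i)
      rw [Real.dist_eq, Complex.dist_eq, ← Complex.ofReal_re (b₀ i), ← Complex.sub_re]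
      exact Complex.abs_re_le_norm _
    have hreB : (fun i => ((b i).re : ℂ)) ∈
        Metric.ball (fun i => (b₀ i : ℂ)) (min ε₁ ε₂) := by
      rw [Metric.mem_ball, dist_pi_lt_iff (lt_min hε₁ hε₂)] at hre ⊢
      intro i
      rw [Complex.dist_eq, ← Complex.ofReal_sub, Complex.norm_real]
      exact hre i
    -- The line through Re b in the direction Im b consists of real points for real parameters and
    -- reaches b at the parameter I.
    have hbeq : b = (fun i => ((b i).re : ℂ)) + Complex.I • fun i => ((b i).im : ℂ) := by
      ext i
      simp [mul_comm Complex.I]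
    show F b = 0
    rw [hbeq]
    refine DifferentiableOn.eq_zero_of_eventually_line (B := Metric.ball _ (min ε₁ ε₂))
      Metric.isOpen_ball (convex_ball _ _)
      (hFd.mono ((Metric.ball_subset_ball (min_le_left _ _)).trans hball)) hreB ?_
      (by rwa [← hbeq])
    have hcont : Continuous fun t : ℝ => fun i => (b i).re + t * (b i).im := by fun_prop
    have := hcont.tendsto' 0 (fun i => (b i).re) (by simp)
    filter_upwards [this.eventually (Metric.isOpen_ball.mem_nhds
      (Metric.ball_subset_ball (min_le_right _ _) hre))] with t ht
    have := hreal _ ht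
    simp only [hF, sub_eq_zero]
    convert this using 2 <;> · ext i; simp
  · rintro b ⟨hbW, hbV⟩
    obtain ⟨ε, hε, hball⟩ := Metric.isOpen_iff.1 hV _ hbV
    obtain ⟨w, hw, hwb⟩ := Metric.mem_closure_iff.1 hbW ε hε
    rw [hW, mem_interior_iff_mem_nhds]
    filter_upwards [Metric.ball_mem_nhds _ hε] with z hz
    -- F vanishes on a neighbourhood of w, hence near w on the real line towards z.
    have hzeq : z = w + (1 : ℂ) • (z - w) := by simp
    show F z = 0
    rw [hzeq]
    refine DifferentiableOn.eq_zero_of_eventually_line (B := Metric.ball b ε)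
      Metric.isOpen_ball (convex_ball _ _) (hFd.mono hball)
      (by rwa [Metric.mem_ball, dist_comm]) ?_ (by rwa [← hzeq])
    have hcont : Continuous fun t : ℝ => w + (t : ℂ) • (z - w) := by fun_prop
    have := hcont.tendsto' 0 w (by simp)
    filter_upwards [this.eventually (isOpen_interior.mem_nhds hw)] with t ht
    exact show _ ∈ {b | F b = 0} from interior_subset ht

/-- Analytic continuations to a region of continuation are unique. -/
theorem IsAnalyticContinuation.eqOn {s : ℕ} {V : Set (Fin s → ℂ)} (hV : IsContinuationRegion V)
    {F₀ : (Fin s → ℝ) → ℂ} {F G : (Fin s → ℂ) → ℂ} (hF : IsAnalyticContinuation V F₀ F)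
    (hG : IsAnalyticContinuation V F₀ G) : EqOn F G V := by
  refine eqOn_of_eventually_eq_real hV.1 hV.2.1 hF.1 hG.1 (b₀ := fun _ => 1)
    (hV.2.2 _ fun _ => one_pos) ?_
  have : ∀ᶠ b : Fin s → ℝ in 𝓝 fun _ => 1, ∀ i, 0 < b i :=
    eventually_all.2 fun i => (continuous_apply i).continuousAt.eventually
      (lt_mem_nhds (one_pos : (0 : ℝ) < 1))
  filter_upwards [this] with b hb
  rw [hF.2 b hb, hG.2 b hb]

/-- The condition depends only on the sum of the coordinates, which must avoid a closed countable
subset of ℂ; the complement of a countable set in the plane is connected. -/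
theorem isContinuationRegion_regularParams (r : ℕ) :
    IsContinuationRegion (regularParams (r + 1)) := by
  set S : Set ℂ := range fun k : ℕ => -(k : ℂ) with hS
  have hScl : IsClosed S := by
    have : IsClosed (range fun k : ℕ => (k : ℂ)) := by
      have := (Complex.isometry_ofReal.isClosedEmbedding.comp
        Nat.isClosedEmbedding_coe_real).isClosed_range
      convert this using 2
      funext k
      simp
    have h2 := (Homeomorph.neg ℂ).isClosedMap _ this
    rw [← range_comp] at h2
    exact h2
  have hpre : regularParams (r + 1) = (fun b : Fin (r + 1) → ℂ => ∑ i, b i) ⁻¹' Sᶜ := by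
    ext b
    simp only [regularParams, hS, mem_ofPred_eq, mem_preimage, mem_compl_iff, mem_range,
      not_exists, eq_comm (a := ∑ i, b i), ne_eq]
  refine ⟨?_, ?_, ?_⟩
  · rw [hpre]
    exact hScl.isOpen_compl.preimage (by fun_prop)
  · have hc : IsPreconnected Sᶜ :=
      ((countable_range _).isPathConnected_compl_of_one_lt_rank
        (by rw [Complex.rank_real_complex]; norm_num)).isConnected.isPreconnected
    -- Correcting coordinate 0 turns any vector into one with prescribed sum w, so the region is a
    -- continuous image of a connected product.
    have himg : regularParams (r + 1) =
        (fun p : ℂ × (Fin (r + 1) → ℂ) => p.2 + Pi.single 0 (p.1 - ∑ i, p.2 i)) ''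
          (Sᶜ ×ˢ univ) := by
      rw [hpre]
      ext b
      constructor
      · intro hb
        exact ⟨(∑ i, b i, b), ⟨hb, mem_univ _⟩, by simp⟩
      · rintro ⟨⟨w, a⟩, ⟨hw, -⟩, rfl⟩
        simpa [Finset.sum_add_distrib] using hw
    rw [himg]
    refine (hc.prod isPreconnected_univ).image _ (Continuous.continuousOn ?_)
    refine continuous_snd.add ((continuous_single 0).comp ?_)
    fun_prop
  · intro b hb k hk
    have h1 : 0 < ∑ i, b i := Finset.sum_pos (fun i _ => hb i) Finset.univ_nonempty
    have h2 := congrArg Complex.re hk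
    simp at h2
    have : (0 : ℝ) ≤ k := Nat.cast_nonneg k
    linarith

/-! ### Geometry of the simplex and integrability of Dirichlet monomials -/

section Simplex

variable {m : ℕ}

@[simp] theorem baryWeights_zero (t : Fin m → ℝ) : baryWeights t 0 = 1 - ∑ j, t j := rfl

@[simp] theorem baryWeights_succ (t : Fin m → ℝ) (j : Fin m) : baryWeights t j.succ = t j := rfl

theorem sum_baryWeights (t : Fin m → ℝ) : ∑ i, baryWeights t i = 1 := by
  simp [Fin.sum_univ_succ]

theorem mem_stdSimplexE_iff {t : Fin m → ℝ} : t ∈ stdSimplexE m ↔ ∀ i, 0 ≤ baryWeights t i := by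
  simp only [stdSimplexE, mem_ofPred_eq, Fin.forall_fin_succ, baryWeights_zero, baryWeights_succ,
    sub_nonneg]
  exact and_comm

theorem baryWeights_le_one {t : Fin m → ℝ} (ht : t ∈ stdSimplexE m) (i : Fin (m + 1)) :
    baryWeights t i ≤ 1 := by
  rw [← sum_baryWeights t]
  exact Finset.single_le_sum (fun j _ => mem_stdSimplexE_iff.1 ht j) (Finset.mem_univ i)

theorem contDiff_baryWeights {k : WithTop ℕ∞} (i : Fin (m + 1)) :
    ContDiff ℝ k fun t : Fin m → ℝ => baryWeights t i := by
  refine Fin.cases ?_ (fun j => ?_) i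
  · simp only [baryWeights_zero]
    fun_prop
  · simp only [baryWeights_succ]
    fun_prop

@[fun_prop]
theorem continuous_baryWeights (i : Fin (m + 1)) :
    Continuous fun t : Fin m → ℝ => baryWeights t i :=
  (contDiff_baryWeights (k := 0) i).continuous

theorem isClosed_stdSimplexE : IsClosed (stdSimplexE m) := by
  have : stdSimplexE m = ⋂ i, {t | 0 ≤ baryWeights t i} := by
    ext t; simp [mem_stdSimplexE_iff]
  rw [this]
  exact isClosed_iInter fun i => isClosed_le continuous_const (by fun_prop)

theorem stdSimplexE_subset_Icc : stdSimplexE m ⊆ univ.pi fun _ => Icc (0 : ℝ) 1 := fun t ht j _ =>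
  ⟨ht.1 j, by simpa using baryWeights_le_one ht j.succ⟩

theorem isCompact_stdSimplexE : IsCompact (stdSimplexE m) :=
  (isCompact_univ_pi fun _ => isCompact_Icc).of_isClosed_subset isClosed_stdSimplexE
    stdSimplexE_subset_Icc

theorem measurableSet_stdSimplexE : MeasurableSet (stdSimplexE m) :=
  isClosed_stdSimplexE.measurableSet

/-- An involutive linear map preserves volume. -/
theorem LinearMap.measurePreserving_of_involutive {E : Type*} [NormedAddCommGroup E]
    [NormedSpace ℝ E] [FiniteDimensional ℝ E] [MeasurableSpace E] [BorelSpace E] (μ : Measure E)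
    [μ.IsAddHaarMeasure] (f : E →ₗ[ℝ] E) (hf : f ∘ₗ f = LinearMap.id) :
    MeasurePreserving f μ μ := by
  have hdet : LinearMap.det f * LinearMap.det f = 1 := by
    rw [← LinearMap.det_comp, hf, LinearMap.det_id]
  have hne : LinearMap.det f ≠ 0 := fun h => by simp [h] at hdet
  have habs : |(LinearMap.det f)⁻¹| = 1 := by
    rcases mul_self_eq_one_iff.1 hdet with h | h <;> simp [h]
  refine ⟨(LinearMap.continuous_of_finiteDimensional f).measurable, ?_⟩
  rw [Measure.map_linearMap_addHaar_eq_smul_addHaar μ hne, habs]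
  simp

/-- The affine involution of `ℝ^m` which exchanges the barycentric weights `0` and `k + 1`. -/
def barySwap (k : Fin m) (t : Fin m → ℝ) : Fin m → ℝ :=
  Function.update t k (1 - ∑ j, t j)

theorem sum_update_eq (k : Fin m) (t : Fin m → ℝ) (a : ℝ) :
    ∑ j, Function.update t k a j = a + (∑ j, t j - t k) := by
  rw [Finset.sum_update_of_mem (Finset.mem_univ k), Finset.sum_sdiff_eq_sub (Finset.subset_univ _)]
  simp

theorem baryWeights_barySwap (k : Fin m) (t : Fin m → ℝ) (i : Fin (m + 1)) :
    baryWeights (barySwap k t) i = baryWeights t (Equiv.swap 0 k.succ i) := by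
  refine Fin.cases ?_ (fun j => ?_) i
  · rw [Equiv.swap_apply_left, baryWeights_zero, baryWeights_succ, barySwap, sum_update_eq]
    ring
  · rw [baryWeights_succ, barySwap]
    by_cases h : j = k
    · subst h; simp
    · rw [Function.update_of_ne h, Equiv.swap_apply_of_ne_of_ne (Fin.succ_ne_zero j)
        (fun h' => h (Fin.succ_injective _ h')), baryWeights_succ]

theorem barySwap_barySwap (k : Fin m) (t : Fin m → ℝ) : barySwap k (barySwap k t) = t := by
  ext j
  rw [← baryWeights_succ (barySwap k (barySwap k t)), baryWeights_barySwap, baryWeights_barySwap,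
    Equiv.swap_apply_self,
    baryWeights_succ]

theorem continuous_barySwap (k : Fin m) : Continuous (barySwap k) := by
  unfold barySwap
  fun_prop

/-- The linear part is an involution, so its determinant is ±1; the rest is a translation by a unit
vector. -/
theorem measurePreserving_barySwap (k : Fin m) : MeasurePreserving (barySwap k) := by
  let f : (Fin m → ℝ) →ₗ[ℝ] (Fin m → ℝ) :=
    { toFun := fun t => Function.update t k (-∑ j, t j)
      map_add' := fun x y => by
        ext j
        by_cases h : j = k
        · subst h; simp [Finset.sum_add_distrib]; ring
        · simp [h]
      map_smul' := fun c x => by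
        ext j
        by_cases h : j = k
        · subst h; simp [Finset.mul_sum]
        · simp [h] }
  have hf : f ∘ₗ f = LinearMap.id := by
    refine LinearMap.ext fun t => funext fun j => ?_
    show Function.update (Function.update t k (-∑ j, t j)) k
      (-∑ j, Function.update t k (-∑ j, t j) j) j = t j
    by_cases h : j = k
    · subst h; rw [sum_update_eq]; simp
    · simp [h]
  have := (measurePreserving_add_left volume (Pi.single k (1 : ℝ) : Fin m → ℝ)).comp
    (LinearMap.measurePreserving_of_involutive volume f hf)
  have heq : barySwap k = (fun t => (Pi.single k (1 : ℝ) : Fin m → ℝ) + t) ∘ f := by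
    funext t j
    show Function.update t k _ j = (Pi.single k (1 : ℝ) : Fin m → ℝ) j + Function.update t k _ j
    by_cases h : j = k
    · subst h; simp; ring
    · simp [h]
  rwa [heq]

theorem measurableEmbedding_barySwap (k : Fin m) : MeasurableEmbedding (barySwap k) :=
  (Homeomorph.mk (Equiv.mk (barySwap k) (barySwap k) (barySwap_barySwap k) (barySwap_barySwap k))
    (continuous_barySwap k) (continuous_barySwap k)).measurableEmbedding

/-- Coordinate hyperplanes are null, and a swap carries the face of weight 0 to one of them. For m =
0 the only weight is 1. -/
theorem ae_baryWeights_ne_zero (i : Fin (m + 1)) :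
    ∀ᵐ t : Fin m → ℝ, baryWeights t i ≠ 0 := by
  have hsucc : ∀ j : Fin m, ∀ᵐ t : Fin m → ℝ, baryWeights t j.succ ≠ 0 := fun j => by
    rw [ae_iff]
    simpa [volume_pi] using Measure.pi_hyperplane (fun _ : Fin m => (volume : Measure ℝ)) j 0
  refine Fin.cases ?_ hsucc i
  rcases m with _ | m
  · exact Eventually.of_forall fun t => by simp
  · filter_upwards [(measurePreserving_barySwap 0).quasiMeasurePreserving.ae (hsucc 0)] with t ht
    rwa [baryWeights_barySwap, Equiv.swap_apply_right] at ht

theorem ae_stdSimplexE_pos :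
    ∀ᵐ t ∂(volume.restrict (stdSimplexE m)), ∀ i, baryWeights t i ∈ Ioc (0 : ℝ) 1 := by
  filter_upwards [ae_restrict_mem measurableSet_stdSimplexE,
    ae_restrict_of_ae (ae_all_iff.2 (ae_baryWeights_ne_zero (m := m)))] with t ht h0 i
  exact ⟨lt_of_le_of_ne (mem_stdSimplexE_iff.1 ht i) (h0 i).symm, baryWeights_le_one ht i⟩

/-- The monomials `∏ t_i ^ (b_i - 1)` with `b_i > 0` are integrable over the simplex. -/
theorem integrableOn_prod_rpow_stdSimplexE {b : Fin (m + 1) → ℝ} (hb : ∀ i, 0 < b i) :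
    IntegrableOn (fun t => ∏ i, baryWeights t i ^ (b i - 1)) (stdSimplexE m) := by
  -- The m + 1 weights sum to 1, so one of them is at least 1/(m + 1): the sets `K i` cover the
  -- simplex.
  set a : ℝ := ((m : ℝ) + 1)⁻¹ with ha
  have ha0 : 0 < a := by positivity
  let K : Fin (m + 1) → Set (Fin m → ℝ) := fun i => stdSimplexE m ∩ {t | a ≤ baryWeights t i}
  have hKc : ∀ i, IsCompact (K i) := fun i =>
    isCompact_stdSimplexE.inter_right (isClosed_le continuous_const (by fun_prop))
  -- On `K 0` the factor with weight 0 is continuous, and the other factors form a product of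
  -- integrable one-variable powers on the cube. Swapping weights reduces every `K i` to this case.
  have hzero : ∀ b : Fin (m + 1) → ℝ, (∀ i, 0 < b i) →
      IntegrableOn (fun t => ∏ i, baryWeights t i ^ (b i - 1)) (K 0) := by
    intro b hb
    have h1 : IntegrableOn (fun t : Fin m → ℝ => ∏ j, t j ^ (b j.succ - 1))
        (univ.pi fun _ => Icc (0 : ℝ) 1) := by
      rw [IntegrableOn, volume_pi, Measure.restrict_pi_pi]
      refine Integrable.fintype_prod (f := fun (j : Fin m) (x : ℝ) => x ^ (b j.succ - 1))
        fun j => ?_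
      rw [← IntegrableOn, integrableOn_Icc_iff_integrableOn_Ioc,
        ← intervalIntegrable_iff_integrableOn_Ioc_of_le zero_le_one]
      exact intervalIntegral.intervalIntegrable_rpow' (by linarith [hb j.succ])
    have h2 : IntegrableOn (fun t : Fin m → ℝ => ∏ j, t j ^ (b j.succ - 1)) (K 0) :=
      h1.mono_set (inter_subset_left.trans stdSimplexE_subset_Icc)
    have h3 : ContinuousOn (fun t : Fin m → ℝ => baryWeights t 0 ^ (b 0 - 1)) (K 0) :=
      (continuous_baryWeights 0).continuousOn.rpow_const fun t ht =>
        Or.inl (ha0.trans_le ht.2).ne'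
    refine (h2.continuousOn_mul h3 (hKc 0)).congr_fun (fun t _ => ?_) (hKc 0).measurableSet
    simp only [Fin.prod_univ_succ, baryWeights_succ]
  have hall : ∀ i, IntegrableOn (fun t => ∏ i, baryWeights t i ^ (b i - 1)) (K i) := by
    refine Fin.cases (hzero b hb) fun k => ?_
    have h1 := hzero (fun i => b (Equiv.swap 0 k.succ i)) fun i => hb _
    rw [← (measurePreserving_barySwap k).integrableOn_comp_preimage
      (measurableEmbedding_barySwap k)] at h1
    convert h1 using 1
    · funext t
      simp only [Function.comp, baryWeights_barySwap]
      exact (Equiv.prod_comp (Equiv.swap 0 k.succ) fun i => baryWeights t i ^ (b i - 1)).symm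
    · ext t
      simp only [K, mem_inter_iff, mem_preimage, mem_stdSimplexE_iff, mem_ofPred_eq,
        baryWeights_barySwap, Equiv.swap_apply_left]
      refine and_congr_left' ⟨fun h i => h _, fun h i => ?_⟩
      simpa using h (Equiv.swap 0 k.succ i)
  refine ((integrableOn_finite_iUnion).2 hall).mono_set fun t ht => ?_
  by_contra hcon
  simp only [K, mem_iUnion, mem_inter_iff, mem_ofPred_eq, not_exists, not_and, not_le] at hcon
  have : ∑ i, baryWeights t i < ∑ _i : Fin (m + 1), a :=
    Finset.sum_lt_sum_of_nonempty Finset.univ_nonempty fun i _ => hcon i ht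
  rw [sum_baryWeights] at this
  simp only [Finset.sum_const, Finset.card_univ, Fintype.card_fin, nsmul_eq_mul, ha] at this
  push_cast at this
  rw [mul_inv_cancel₀ (by positivity)] at this
  exact lt_irrefl _ this

end Simplex

/-! ### Averages divided by Γ(c), for parameters with positive real parts -/

section ReducedAverage

variable {m : ℕ}

/-- The half space of the parameter vectors all of whose real parts exceed `-T`. -/
def paramHalfSpace (m : ℕ) (T : Fin (m + 1) → ℝ) : Set (Fin (m + 1) → ℂ) :=
  {b | ∀ i, -T i < (b i).re}

/-- The integral `∫_{E_m} h(∑ u_i z_i) ∏ u_i ^ (b_i - 1) du / ∏ Γ(b_i)`, which is the Dirichlet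
average of `h` divided by `Γ(∑ b_i)`. -/
noncomputable def reducedAverage (h : ℝ → ℂ) (b : Fin (m + 1) → ℂ) (z : Fin (m + 1) → ℝ) : ℂ :=
  (∏ i, (Complex.Gamma (b i))⁻¹) * ∫ t in stdSimplexE m,
    h (∑ i, baryWeights t i * z i) * ∏ i, (baryWeights t i : ℂ) ^ (b i - 1)

theorem isOpen_paramHalfSpace (T : Fin (m + 1) → ℝ) : IsOpen (paramHalfSpace m T) := by
  have : paramHalfSpace m T = ⋂ i, {b | -T i < (b i).re} := by
    ext b; simp [paramHalfSpace]
  rw [this]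
  exact isOpen_iInter_of_finite fun i => isOpen_lt continuous_const (by fun_prop)

theorem convex_paramHalfSpace (T : Fin (m + 1) → ℝ) : Convex ℝ (paramHalfSpace m T) := by
  intro x hx y hy a b ha hb hab i
  have h1 := hx i
  have h2 := hy i
  simp only [Pi.add_apply, Pi.smul_apply, Complex.add_re, Complex.smul_re, smul_eq_mul]
  have : -T i = a * (-T i) + b * (-T i) := by rw [← add_mul, hab, one_mul]
  rw [this]
  rcases ha.eq_or_lt with rfl | ha
  · have hb1 : b = 1 := by linarith
    subst hb1
    linarith
  · nlinarith [mul_lt_mul_of_pos_left h1 ha, mul_le_mul_of_nonneg_left h2.le hb]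

theorem isContinuationRegion_paramHalfSpace {T : Fin (m + 1) → ℝ} (hT : ∀ i, 0 ≤ T i) :
    IsContinuationRegion (paramHalfSpace m T) :=
  ⟨isOpen_paramHalfSpace T, (convex_paramHalfSpace T).isPreconnected, fun b hb i => by
    simpa using (neg_nonpos.2 (hT i)).trans_lt (hb i)⟩

/-- Near a parameter vector with positive real parts, the monomials have an integrable
majorant. -/
theorem norm_prod_cpow_le_of_mem_ball {b₀ b : Fin (m + 1) → ℂ} {ε : ℝ}
    (hε : ∀ i, 2 * ε ≤ (b₀ i).re) (hb : b ∈ Metric.ball b₀ ε) {t : Fin m → ℝ}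
    (ht : ∀ i, baryWeights t i ∈ Ioc (0 : ℝ) 1) :
    ‖∏ i, (baryWeights t i : ℂ) ^ (b i - 1)‖ ≤ ∏ i, baryWeights t i ^ (ε - 1) := by
  rw [norm_prod]
  refine Finset.prod_le_prod (fun i _ => norm_nonneg _) fun i _ => ?_
  rw [Complex.norm_cpow_eq_rpow_re_of_pos (ht i).1]
  refine Real.rpow_le_rpow_of_exponent_ge (ht i).1 (ht i).2 ?_
  have h1 : dist (b i) (b₀ i) < ε := (dist_le_pi_dist b b₀ i).trans_lt hb
  rw [Complex.dist_eq] at h1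
  have h2 := (abs_lt.1 ((Complex.abs_re_le_norm _).trans_lt h1)).1
  have h3 := hε i
  simp only [Complex.sub_re, Complex.one_re] at h2 ⊢
  linarith

theorem exists_pos_two_mul_le_re {b₀ : Fin (m + 1) → ℂ} (hb₀ : b₀ ∈ paramHalfSpace m 0) :
    ∃ ε > 0, ∀ i, 2 * ε ≤ (b₀ i).re := by
  obtain ⟨i₀, hi₀⟩ := Finite.exists_min fun i => (b₀ i).re
  have : 0 < (b₀ i₀).re := by simpa using hb₀ i₀
  exact ⟨(b₀ i₀).re / 2, by positivity, fun i => by linarith [hi₀ i]⟩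

theorem aestronglyMeasurable_kernel {h : ℝ → ℂ} (hh : Continuous h) (b : Fin (m + 1) → ℂ)
    (z : Fin (m + 1) → ℝ) :
    AEStronglyMeasurable (fun t => h (∑ i, baryWeights t i * z i) *
      ∏ i, (baryWeights t i : ℂ) ^ (b i - 1)) (volume.restrict (stdSimplexE m)) := by
  refine AEStronglyMeasurable.mul (Continuous.aestronglyMeasurable (by fun_prop)) ?_
  refine Measurable.aestronglyMeasurable ?_
  refine Finset.measurable_fun_prod _ fun i _ => ?_
  have : Measurable fun t : Fin m → ℝ => (baryWeights t i : ℂ) :=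
    (Complex.continuous_ofReal.comp (continuous_baryWeights i)).measurable
  exact this.pow_const _

theorem exists_norm_le_of_bounded {h : ℝ → ℂ} (hh : Continuous h)
    {Z : Set (Fin (m + 1) → ℝ)} (hZ : IsCompact Z) :
    ∃ C, ∀ z ∈ Z, ∀ t ∈ stdSimplexE m, ‖h (∑ i, baryWeights t i * z i)‖ ≤ C := by
  have hc : Continuous fun p : (Fin (m + 1) → ℝ) × (Fin m → ℝ) =>
      h (∑ i, baryWeights p.2 i * p.1 i) := by
    refine hh.comp (continuous_finsetSum _ fun i _ => ?_)
    exact ((continuous_baryWeights i).comp continuous_snd).mul (by fun_prop)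
  obtain ⟨C, hC⟩ := (hZ.prod isCompact_stdSimplexE).exists_bound_of_continuousOn hc.continuousOn
  exact ⟨C, fun z hz t ht => hC (z, t) ⟨hz, ht⟩⟩

theorem differentiable_fun_prod {E : Type*} [NormedAddCommGroup E] [NormedSpace ℂ E] {ι : Type*}
    [Fintype ι] [DecidableEq ι] {f : ι → E → ℂ} (hf : ∀ i, Differentiable ℂ (f i)) :
    Differentiable ℂ fun x => ∏ i, f i x := fun x =>
  (HasFDerivAt.finsetProd fun i _ => (hf i x).hasFDerivAt).differentiableAt

theorem differentiable_prod_inv_Gamma :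
    Differentiable ℂ fun b : Fin (m + 1) → ℂ => ∏ i, (Complex.Gamma (b i))⁻¹ := by
  refine differentiable_fun_prod fun i => ?_
  exact Complex.differentiable_one_div_Gamma.comp (differentiable_apply i)

theorem differentiableOn_reducedAverage {h : ℝ → ℂ} (hh : Continuous h) (z : Fin (m + 1) → ℝ) :
    DifferentiableOn ℂ (fun b => reducedAverage h b z) (paramHalfSpace m 0) := by
  refine differentiable_prod_inv_Gamma.differentiableOn.mul ?_
  refine differentiableOn_integral_of_dominated (isOpen_paramHalfSpace 0)
    (fun b _ => aestronglyMeasurable_kernel hh b z) ?_ ?_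
  · filter_upwards [ae_stdSimplexE_pos] with t ht
    refine Differentiable.differentiableOn ?_
    refine (differentiable_const _).mul (differentiable_fun_prod fun i => ?_)
    refine Differentiable.const_cpow (by fun_prop) (Or.inl ?_)
    exact_mod_cast (ht i).1.ne'
  · intro b₀ hb₀
    obtain ⟨ε, hε, hεb⟩ := exists_pos_two_mul_le_re hb₀
    obtain ⟨C, hC⟩ := exists_norm_le_of_bounded (m := m) hh (isCompact_singleton (x := z))
    refine ⟨ε, hε, fun t => C * ∏ i, baryWeights t i ^ (ε - 1),
      (integrableOn_prod_rpow_stdSimplexE (b := fun _ => ε) fun _ => hε).const_mul C, ?_⟩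
    filter_upwards [ae_restrict_mem measurableSet_stdSimplexE, ae_stdSimplexE_pos] with t htE ht b hb
    rw [norm_mul]
    have h1 := hC z rfl t htE
    exact mul_le_mul h1 (norm_prod_cpow_le_of_mem_ball hεb hb ht) (norm_nonneg _)
      ((norm_nonneg _).trans h1)

/-- Dominated convergence: near b₀ and for nodes in a compact ball, one monomial with all exponents
ε − 1, times a bound for h, dominates all integrands. -/
theorem continuousOn_reducedAverage {h : ℝ → ℂ} (hh : Continuous h) :
    ContinuousOn (fun p : (Fin (m + 1) → ℂ) × (Fin (m + 1) → ℝ) => reducedAverage h p.1 p.2)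
      (paramHalfSpace m 0 ×ˢ univ) := by
  rintro ⟨b₀, z₀⟩ ⟨hb₀, -⟩
  refine ContinuousAt.continuousWithinAt ?_
  refine ContinuousAt.mul (f := fun p : (Fin (m + 1) → ℂ) × (Fin (m + 1) → ℝ) =>
    ∏ i, (Complex.Gamma (p.1 i))⁻¹)
    (differentiable_prod_inv_Gamma.continuous.comp continuous_fst).continuousAt ?_
  obtain ⟨ε, hε, hεb⟩ := exists_pos_two_mul_le_re hb₀
  obtain ⟨C, hC⟩ := exists_norm_le_of_bounded (m := m) hh (isCompact_closedBall z₀ 1)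
  refine continuousAt_of_dominated (bound := fun t => C * ∏ i, baryWeights t i ^ (ε - 1))
    (Eventually.of_forall fun p => aestronglyMeasurable_kernel hh p.1 p.2) ?_
    ((integrableOn_prod_rpow_stdSimplexE (b := fun _ => ε) fun _ => hε).const_mul C) ?_
  · filter_upwards [prod_mem_nhds (Metric.ball_mem_nhds b₀ hε)
      (Metric.closedBall_mem_nhds z₀ one_pos)] with p hp
    filter_upwards [ae_restrict_mem measurableSet_stdSimplexE, ae_stdSimplexE_pos] with t htE ht
    rw [norm_mul]
    have h1 := hC p.2 hp.2 t htE
    exact mul_le_mul h1 (norm_prod_cpow_le_of_mem_ball hεb hp.1 ht) (norm_nonneg _)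
      ((norm_nonneg _).trans h1)
  · filter_upwards [ae_stdSimplexE_pos] with t ht
    refine Continuous.continuousAt ?_
    refine Continuous.mul (by fun_prop) (continuous_finsetProd _ fun i _ => ?_)
    refine Continuous.const_cpow (by fun_prop) (Or.inl ?_)
    exact_mod_cast (ht i).1.ne'

theorem ofReal_prod_rpow {b : Fin (m + 1) → ℝ} {t : Fin m → ℝ} (ht : t ∈ stdSimplexE m) :
    ((∏ i, baryWeights t i ^ (b i - 1) : ℝ) : ℂ) =
      ∏ i, (baryWeights t i : ℂ) ^ ((b i : ℂ) - 1) := by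
  rw [Complex.ofReal_prod]
  refine Finset.prod_congr rfl fun i _ => ?_
  rw [Complex.ofReal_cpow (mem_stdSimplexE_iff.1 ht i)]
  simp

theorem dirichletDensity_eq (b : Fin (m + 1) → ℝ) (t : Fin m → ℝ) :
    dirichletDensity b t = Real.Gamma (∑ i, b i) * (∏ i, (Real.Gamma (b i))⁻¹) *
      ∏ i, baryWeights t i ^ (b i - 1) := by
  rw [dirichletDensity, Finset.prod_mul_distrib, mul_assoc]

/-- Separates Γ(c), the only factor that can have poles once the reduced average is continued. -/
theorem dirichletAverage_eq (h : ℝ → ℂ) (b : Fin (m + 1) → ℝ) (z : Fin (m + 1) → ℝ) :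
    dirichletAverage h b z =
      Complex.Gamma (∑ i, (b i : ℂ)) * reducedAverage h (fun i => (b i : ℂ)) z := by
  rw [reducedAverage, dirichletAverage, ← mul_assoc, ← integral_const_mul]
  refine setIntegral_congr_fun measurableSet_stdSimplexE fun t ht => ?_
  simp only [dirichletDensity_eq]
  rw [Complex.ofReal_mul, ofReal_prod_rpow ht, Complex.ofReal_mul, Complex.ofReal_prod,
    ← Complex.ofReal_sum, Complex.Gamma_ofReal]
  simp only [Complex.ofReal_inv, Complex.Gamma_ofReal]
  ring

theorem integrableOn_dirichletDensity {b : Fin (m + 1) → ℝ} (hb : ∀ i, 0 < b i) :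
    IntegrableOn (dirichletDensity b) (stdSimplexE m) := by
  have := (integrableOn_prod_rpow_stdSimplexE hb).const_mul
    (Real.Gamma (∑ i, b i) * (∏ i, (Real.Gamma (b i))⁻¹))
  rwa [funext (dirichletDensity_eq b)]

theorem dirichletDensity_nonneg {b : Fin (m + 1) → ℝ} (hb : ∀ i, 0 < b i) {t : Fin m → ℝ}
    (ht : t ∈ stdSimplexE m) : 0 ≤ dirichletDensity b t := by
  refine mul_nonneg (Real.Gamma_nonneg_of_nonneg (Finset.sum_nonneg fun i _ => (hb i).le))
    (Finset.prod_nonneg fun i _ => mul_nonneg (inv_nonneg.2 (Real.Gamma_nonneg_of_nonneg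
      (hb i).le)) (Real.rpow_nonneg (mem_stdSimplexE_iff.1 ht i) _))

end ReducedAverage

/-! ### Integration by parts and the recurrence in the parameters -/

section Recurrence

variable {m : ℕ}

/-- The unnormalized average `∫_{E_m} h(∑ u_i z_i) ∏ u_i ^ (b_i - 1) du`. -/
noncomputable def simplexIntegral (h : ℝ → ℂ) (b : Fin (m + 1) → ℂ) (z : Fin (m + 1) → ℝ) : ℂ :=
  ∫ t in stdSimplexE m, h (∑ i, baryWeights t i * z i) * ∏ i, (baryWeights t i : ℂ) ^ (b i - 1)

/-- The product `∏ max(t_i, 0) ^ q_i` of powers of the positive parts of the weights. -/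
noncomputable def posMonomial (q : Fin (m + 1) → ℝ) (t : Fin m → ℝ) : ℝ :=
  ∏ i, max (baryWeights t i) 0 ^ q i

/-- For p > 1 the two one-sided derivatives at 0 both vanish. This makes the monomials, extended by
zero, differentiable on all of ℝ^m, so that no boundary terms arise. -/
theorem hasDerivAt_max_zero_rpow {p : ℝ} (hp : 1 < p) (x : ℝ) :
    HasDerivAt (fun x : ℝ => max x 0 ^ p) (p * max x 0 ^ (p - 1)) x := by
  rcases lt_trichotomy x 0 with hx | rfl | hx
  · rw [max_eq_right hx.le, Real.zero_rpow (by linarith), mul_zero]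
    refine (hasDerivAt_const x (0 : ℝ)).congr_of_eventuallyEq ?_
    filter_upwards [gt_mem_nhds hx] with y hy
    rw [max_eq_right hy.le, Real.zero_rpow (by linarith)]
  · have h1 : HasDerivWithinAt (fun x : ℝ => max x 0 ^ p) (p * max (0 : ℝ) 0 ^ (p - 1))
        (Ici 0) 0 := by
      rw [max_self]
      refine (Real.hasDerivAt_rpow_const (Or.inr hp.le)).hasDerivWithinAt.congr
        (fun y hy => ?_) (by simp)
      rw [max_eq_left hy]
    have h2 : HasDerivWithinAt (fun x : ℝ => max x 0 ^ p) (p * max (0 : ℝ) 0 ^ (p - 1))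
        (Iic 0) 0 := by
      rw [max_self, Real.zero_rpow (by linarith), mul_zero]
      refine (hasDerivWithinAt_const _ _ (0 : ℝ)).congr (fun y hy => ?_) ?_
      · rw [max_eq_right hy, Real.zero_rpow (by linarith)]
      · rw [max_self, Real.zero_rpow (by linarith)]
    have h3 := h1.union h2
    rwa [Ici_union_Iic, hasDerivWithinAt_univ] at h3
  · rw [max_eq_left hx.le]
    refine (Real.hasDerivAt_rpow_const (Or.inl hx.ne')).congr_of_eventuallyEq ?_
    filter_upwards [lt_mem_nhds hx] with y hy
    rw [max_eq_left hy.le]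

/-- The direction in `ℝ^m` along which the weight `i` grows and the weight `k` decreases. -/
def baryDirection (i k : Fin (m + 1)) : Fin m → ℝ := fun j =>
  (Pi.single i 1 - Pi.single k 1 : Fin (m + 1) → ℝ) j.succ

theorem baryWeights_add_smul_baryDirection (i k : Fin (m + 1)) (t : Fin m → ℝ) (x : ℝ)
    (j : Fin (m + 1)) :
    baryWeights (t + x • baryDirection i k) j =
      baryWeights t j + x * (Pi.single i 1 - Pi.single k 1 : Fin (m + 1) → ℝ) j := by
  refine Fin.cases ?_ (fun j => ?_) j
  · have h : ∑ j, (Pi.single i 1 - Pi.single k 1 : Fin (m + 1) → ℝ) j = 0 := by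
      simp
    rw [Fin.sum_univ_succ] at h
    simp only [baryWeights_zero, Pi.add_apply, Pi.smul_apply, smul_eq_mul, baryDirection,
      Finset.sum_add_distrib, ← Finset.mul_sum]
    rw [eq_neg_of_add_eq_zero_right h]
    ring
  · simp [baryDirection]

theorem hasLineDerivAt_posMonomial {q : Fin (m + 1) → ℝ} (hq : ∀ j, 1 < q j)
    (i k : Fin (m + 1)) (t : Fin m → ℝ) :
    HasLineDerivAt ℝ (posMonomial q) (q i * posMonomial (q - Pi.single i 1) t -
      q k * posMonomial (q - Pi.single k 1) t) t (baryDirection i k) := by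
  set δ : Fin (m + 1) → ℝ := Pi.single i 1 - Pi.single k 1 with hδ
  have h1 : ∀ j, HasDerivAt (fun x : ℝ => max (baryWeights t j + x * δ j) 0 ^ q j)
      (q j * max (baryWeights t j) 0 ^ (q j - 1) * δ j) 0 := fun j => by
    have h2 : HasDerivAt (fun x : ℝ => baryWeights t j + x * δ j) (δ j) 0 := by
      simpa using ((hasDerivAt_id (0 : ℝ)).mul_const (δ j)).const_add (baryWeights t j)
    refine HasDerivAt.comp_of_eq (y := baryWeights t j) (0 : ℝ)
      (hasDerivAt_max_zero_rpow (hq j) _) h2 (by simp)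
  have h3 := HasDerivAt.fun_finsetProd (u := Finset.univ) fun j _ => h1 j
  have h4 : ∀ l, (∏ j ∈ Finset.univ.erase l, max (baryWeights t j) 0 ^ q j) *
      (q l * max (baryWeights t l) 0 ^ (q l - 1)) = q l * posMonomial (q - Pi.single l 1) t := by
    intro l
    rw [posMonomial, ← Finset.mul_prod_erase Finset.univ _ (Finset.mem_univ l)]
    have : ∏ j ∈ Finset.univ.erase l, max (baryWeights t j) 0 ^ (q - Pi.single l 1 : _ → ℝ) j =
        ∏ j ∈ Finset.univ.erase l, max (baryWeights t j) 0 ^ q j :=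
      Finset.prod_congr rfl fun j hj => by
        simp [Finset.ne_of_mem_erase hj]
    rw [this]
    simp
    ring
  have h5 : ∀ l, (∏ j ∈ Finset.univ.erase l, max (baryWeights t j + 0 * δ j) 0 ^ q j) •
      (q l * max (baryWeights t l) 0 ^ (q l - 1) * δ l) =
        q l * posMonomial (q - Pi.single l 1) t * δ l := fun l => by
    rw [← h4 l]
    simp only [zero_mul, add_zero, smul_eq_mul, mul_assoc]
  have hfun : (fun x : ℝ => posMonomial q (t + x • baryDirection i k)) =
      fun x => ∏ j, max (baryWeights t j + x * δ j) 0 ^ q j := by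
    funext x
    simp only [posMonomial, baryWeights_add_smul_baryDirection, hδ]
  unfold HasLineDerivAt
  rw [hfun]
  refine h3.congr_deriv ?_
  rw [Finset.sum_congr rfl fun l _ => h5 l]
  have h6 : ∀ P : Fin (m + 1) → ℝ, ∑ l, P l * δ l = P i - P k := fun P => by
    simp [hδ, mul_sub, Finset.sum_sub_distrib, Pi.single_apply]
  exact h6 fun l => q l * posMonomial (q - Pi.single l 1) t

theorem posMonomial_eq_zero {q : Fin (m + 1) → ℝ} (hq : ∀ j, 0 < q j) {t : Fin m → ℝ}
    (ht : t ∉ stdSimplexE m) : posMonomial q t = 0 := by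
  rw [mem_stdSimplexE_iff] at ht
  push Not at ht
  obtain ⟨i, hi⟩ := ht
  refine Finset.prod_eq_zero (Finset.mem_univ i) ?_
  rw [max_eq_right hi.le, Real.zero_rpow (hq i).ne']

theorem continuous_posMonomial {q : Fin (m + 1) → ℝ} (hq : ∀ j, 0 < q j) :
    Continuous (posMonomial q) :=
  continuous_finsetProd _ fun i _ =>
    ((continuous_baryWeights i).max continuous_const).rpow_const fun _ => Or.inr (hq i).le

theorem integrable_mul_posMonomial {f : (Fin m → ℝ) → ℂ} (hf : Continuous f)
    {q : Fin (m + 1) → ℝ} (hq : ∀ j, 0 < q j) :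
    Integrable fun t => f t * (posMonomial q t : ℂ) := by
  refine Continuous.integrable_of_hasCompactSupport
    (hf.mul (Complex.continuous_ofReal.comp (continuous_posMonomial hq))) ?_
  refine HasCompactSupport.intro isCompact_stdSimplexE fun t ht => ?_
  simp [posMonomial_eq_zero hq ht]

theorem simplexIntegral_eq_integral_posMonomial (h : ℝ → ℂ) {b : Fin (m + 1) → ℝ}
    (hb : ∀ j, 1 < b j) (z : Fin (m + 1) → ℝ) :
    simplexIntegral h (fun i => (b i : ℂ)) z =
      ∫ t : Fin m → ℝ, h (∑ i, baryWeights t i * z i) * (posMonomial (b - 1) t : ℂ) := by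
  have hq : ∀ j, 0 < (b - 1) j := fun j => by simpa using hb j
  rw [← setIntegral_eq_integral_of_forall_compl_eq_zero (s := stdSimplexE m)
    fun t ht => by simp [posMonomial_eq_zero hq ht]]
  refine setIntegral_congr_fun measurableSet_stdSimplexE fun t ht => ?_
  simp only
  rw [← ofReal_prod_rpow ht, posMonomial]
  congr 3 with i
  rw [max_eq_left (mem_stdSimplexE_iff.1 ht i)]
  rfl

/-- Integration by parts over the simplex. -/
theorem simplexIntegral_by_parts {h : ℝ → ℂ} (hh : ContDiff ℝ 1 h) {b : Fin (m + 1) → ℝ}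
    (hb : ∀ j, 2 < b j) (z : Fin (m + 1) → ℝ) (i k : Fin (m + 1)) :
    ((b i : ℂ) - 1) * simplexIntegral h (fun j => ((b - Pi.single i 1 : _ → ℝ) j : ℂ)) z -
      ((b k : ℂ) - 1) * simplexIntegral h (fun j => ((b - Pi.single k 1 : _ → ℝ) j : ℂ)) z =
      -((z i - z k : ℝ) * simplexIntegral (deriv h) (fun j => (b j : ℂ)) z) := by
  -- The bound 2 < b_j leaves positive exponents b_j − 2 even after lowering, so all integrands
  -- below are continuous with compact support.
  have hsub : ∀ l j, 1 < (b - Pi.single l 1 : _ → ℝ) j := fun l j => by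
    have := hb j
    by_cases hjl : j = l
    · subst hjl; simp; linarith
    · simp [hjl]; linarith
  have hq : ∀ j, 1 < (b - 1) j := fun j => by
    have := hb j
    simp; linarith
  have hql : ∀ l j, 0 < (b - Pi.single l 1 - 1 : _ → ℝ) j := fun l j => by
    simpa using hsub l j
  have hcomm : ∀ l, b - Pi.single l 1 - 1 = b - 1 - Pi.single l 1 := fun l => sub_right_comm _ _ _
  rw [simplexIntegral_eq_integral_posMonomial h (hsub i),
    simplexIntegral_eq_integral_posMonomial h (hsub k),
    simplexIntegral_eq_integral_posMonomial _ (fun j => one_lt_two.trans (hb j)),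
    ← integral_const_mul, ← integral_const_mul, ← integral_const_mul, ← integral_sub]
  rotate_left
  · exact (integrable_mul_posMonomial (by fun_prop) (hql i)).const_mul _
  · exact (integrable_mul_posMonomial (by fun_prop) (hql k)).const_mul _
  have hd : Continuous (deriv h) := hh.continuous_deriv le_rfl
  have key := integral_bilinear_hasLineDerivAt_right_eq_neg_left_of_integrable
    (μ := (volume : Measure (Fin m → ℝ))) (B := ContinuousLinearMap.mul ℝ ℂ)
    (v := baryDirection i k)
    (f := fun t => h (∑ j, baryWeights t j * z j))
    (f' := fun t => (z i - z k : ℝ) * deriv h (∑ j, baryWeights t j * z j))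
    (g := fun t => (posMonomial (b - 1) t : ℂ))
    (g' := fun t => (((b - 1) i * posMonomial (b - 1 - Pi.single i 1) t -
      (b - 1) k * posMonomial (b - 1 - Pi.single k 1) t : ℝ) : ℂ)) ?_ ?_ ?_ ?_ ?_
  · simp only [ContinuousLinearMap.mul_apply'] at key
    convert key using 1
    · refine integral_congr_ae (Eventually.of_forall fun t => ?_)
      simp only [hcomm, Pi.sub_apply, Pi.one_apply]
      push_cast
      ring
    · simp only [mul_assoc]
  · simp only [ContinuousLinearMap.mul_apply']
    exact integrable_mul_posMonomial (by fun_prop) fun j => one_pos.trans (hq j)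
  · simp only [ContinuousLinearMap.mul_apply', Complex.ofReal_sub, Complex.ofReal_mul, mul_sub]
    refine Integrable.sub ?_ ?_ <;> simp only [← mul_assoc, ← hcomm]
    · exact integrable_mul_posMonomial (by fun_prop) (hql i)
    · exact integrable_mul_posMonomial (by fun_prop) (hql k)
  · simp only [ContinuousLinearMap.mul_apply']
    exact integrable_mul_posMonomial (by fun_prop) fun j => one_pos.trans (hq j)
  · intro t _
    unfold HasLineDerivAt
    simp only [baryWeights_add_smul_baryDirection]
    have h1 : HasDerivAt (fun x : ℝ => ∑ j, (baryWeights t j +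
        x * (Pi.single i 1 - Pi.single k 1 : Fin (m + 1) → ℝ) j) * z j) (z i - z k) 0 := by
      have : ∀ x : ℝ, ∑ j, (baryWeights t j +
        x * (Pi.single i 1 - Pi.single k 1 : Fin (m + 1) → ℝ) j) * z j =
          ∑ j, baryWeights t j * z j + x * (z i - z k) := fun x => by
        simp [add_mul, sub_mul, mul_sub, Finset.sum_add_distrib,
          Finset.sum_sub_distrib, Pi.single_apply]
      simp only [this]
      simpa using ((hasDerivAt_id (0 : ℝ)).mul_const (z i - z k)).const_add
        (∑ j, baryWeights t j * z j)
    have h2 : HasDerivAt h (deriv h (∑ j, baryWeights t j * z j)) (∑ j, baryWeights t j * z j) :=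
      ((hh.differentiable one_ne_zero) _).hasDerivAt
    have := HasDerivAt.scomp_of_eq (0 : ℝ) h2 h1 (by simp)
    simpa [Function.comp_def] using this
  · intro t _
    exact HasDerivAt.ofReal_comp (hasLineDerivAt_posMonomial hq i k t)

theorem prod_inv_Gamma_add_single {b : Fin (m + 1) → ℂ} {i : Fin (m + 1)} (hb : b i ≠ 0) :
    ∏ j, (Complex.Gamma ((b + Pi.single i 1 : _ → ℂ) j))⁻¹ =
      (b i)⁻¹ * ∏ j, (Complex.Gamma (b j))⁻¹ := by
  have : ∀ j, (Complex.Gamma ((b + Pi.single i 1 : _ → ℂ) j))⁻¹ =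
      (if j = i then (b i)⁻¹ else 1) * (Complex.Gamma (b j))⁻¹ := fun j => by
    by_cases hj : j = i
    · subst hj
      simp [Complex.Gamma_add_one _ hb, mul_comm]
    · simp [hj]
  simp only [this, Finset.prod_mul_distrib, Finset.prod_ite_eq', Finset.mem_univ, if_true]

theorem integrableOn_kernel {h : ℝ → ℂ} (hh : Continuous h) {b : Fin (m + 1) → ℂ}
    (hb : b ∈ paramHalfSpace m 0) (z : Fin (m + 1) → ℝ) :
    IntegrableOn (fun t => h (∑ i, baryWeights t i * z i) *
      ∏ i, (baryWeights t i : ℂ) ^ (b i - 1)) (stdSimplexE m) := by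
  obtain ⟨ε, hε, hεb⟩ := exists_pos_two_mul_le_re hb
  obtain ⟨C, hC⟩ := exists_norm_le_of_bounded (m := m) hh (isCompact_singleton (x := z))
  refine Integrable.mono' (g := fun t => C * ∏ i, baryWeights t i ^ (ε - 1))
    ((integrableOn_prod_rpow_stdSimplexE (b := fun _ => ε) fun _ => hε).const_mul C)
    (aestronglyMeasurable_kernel hh b z) ?_
  filter_upwards [ae_restrict_mem measurableSet_stdSimplexE, ae_stdSimplexE_pos] with t htE ht
  rw [norm_mul]
  have h1 := hC z rfl t htE
  exact mul_le_mul h1 (norm_prod_cpow_le_of_mem_ball hεb (Metric.mem_ball_self hε) ht)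
    (norm_nonneg _) ((norm_nonneg _).trans h1)

theorem add_single_mem_paramHalfSpace {T : Fin (m + 1) → ℝ} {b : Fin (m + 1) → ℂ}
    (hb : b ∈ paramHalfSpace m T) (i : Fin (m + 1)) :
    b + Pi.single i 1 ∈ paramHalfSpace m T := fun j => by
  have := hb j
  by_cases hj : j = i
  · subst hj
    simp
    linarith
  · simpa [hj] using this

/-- Insert 1 = ∑ u_i under the integral; Γ(b_i + 1) = b_i Γ(b_i) supplies the coefficients. -/
theorem reducedAverage_eq_sum {h : ℝ → ℂ} (hh : Continuous h) {b : Fin (m + 1) → ℂ}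
    (hb : b ∈ paramHalfSpace m 0) (z : Fin (m + 1) → ℝ) :
    reducedAverage h b z = ∑ i, b i * reducedAverage h (b + Pi.single i 1) z := by
  have hne : ∀ i, b i ≠ 0 := fun i h0 => by
    have := hb i
    simp [h0] at this
  have h1 : ∀ i, b i * reducedAverage h (b + Pi.single i 1) z =
      (∏ j, (Complex.Gamma (b j))⁻¹) * simplexIntegral h (b + Pi.single i 1) z := fun i => by
    rw [reducedAverage, prod_inv_Gamma_add_single (hne i), ← mul_assoc, ← mul_assoc,
      mul_inv_cancel₀ (hne i), one_mul, simplexIntegral]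
  rw [Finset.sum_congr rfl fun i _ => h1 i, ← Finset.mul_sum, reducedAverage]
  congr 1
  simp only [simplexIntegral]
  rw [← integral_finsetSum _ fun i _ => integrableOn_kernel hh
    (add_single_mem_paramHalfSpace hb i) z]
  refine integral_congr_ae ?_
  filter_upwards [ae_stdSimplexE_pos] with t ht
  have h2 : ∀ i, ∏ j, (baryWeights t j : ℂ) ^ ((b + Pi.single i 1 : _ → ℂ) j - 1) =
      baryWeights t i * ∏ j, (baryWeights t j : ℂ) ^ (b j - 1) := fun i => by
    have : ∀ j, (baryWeights t j : ℂ) ^ ((b + Pi.single i 1 : _ → ℂ) j - 1) =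
        (if j = i then (baryWeights t i : ℂ) else 1) * (baryWeights t j : ℂ) ^ (b j - 1) :=
      fun j => by
        by_cases hj : j = i
        · subst hj
          have h0 : (baryWeights t j : ℂ) ≠ 0 := by exact_mod_cast (ht j).1.ne'
          simp only [Pi.add_apply, Pi.single_eq_same, if_true]
          rw [add_sub_right_comm, Complex.cpow_add _ _ h0, Complex.cpow_one, mul_comm]
        · simp [hj]
    simp only [this, Finset.prod_mul_distrib, Finset.prod_ite_eq', Finset.mem_univ, if_true]
  simp only [h2]
  rw [← Finset.mul_sum, ← Finset.sum_mul, ← Complex.ofReal_sum, sum_baryWeights]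
  simp

/-- Integration by parts at the parameters b + e_i + e_k, whose boundary-free form carries the
coefficients b_i and b_k; the reciprocal Γ-factors cancel them. -/
theorem reducedAverage_add_single_sub {h : ℝ → ℂ} (hh : ContDiff ℝ 1 h) {b : Fin (m + 1) → ℝ}
    (hb : ∀ j, 2 < b j) (z : Fin (m + 1) → ℝ) (i k : Fin (m + 1)) :
    reducedAverage h ((fun j => (b j : ℂ)) + Pi.single i 1) z -
      reducedAverage h ((fun j => (b j : ℂ)) + Pi.single k 1) z =
      (z i - z k : ℝ) *
        reducedAverage (deriv h) ((fun j => (b j : ℂ)) + Pi.single i 1 + Pi.single k 1) z := by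
  rcases eq_or_ne i k with rfl | hik
  · simp
  set β : Fin (m + 1) → ℂ := fun j => (b j : ℂ) with hβ
  have hne : ∀ j, β j ≠ 0 := fun j => by
    have := hb j
    simp only [hβ, ne_eq, Complex.ofReal_eq_zero]
    linarith
  have hne' : (β + Pi.single i 1 : _ → ℂ) k ≠ 0 := by simpa [hik.symm] using hne k
  have h2 : ∀ j, 2 < (b + Pi.single i 1 + Pi.single k 1 : _ → ℝ) j := fun j => by
    have h1 : (0 : Fin (m + 1) → ℝ) ≤ Pi.single i 1 := Pi.single_nonneg.2 zero_le_one
    have h3 : (0 : Fin (m + 1) → ℝ) ≤ Pi.single k 1 := Pi.single_nonneg.2 zero_le_one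
    have := h1 j
    have := h3 j
    have := hb j
    simp only [Pi.add_apply, Pi.zero_apply] at *
    linarith
  have hparts := simplexIntegral_by_parts hh h2 z i k
  have hcast : ∀ (c : Fin (m + 1) → ℝ) l, (fun j => ((c + Pi.single l 1 : _ → ℝ) j : ℂ)) =
      (fun j => (c j : ℂ)) + Pi.single l 1 := fun c l => by
    ext j
    by_cases hj : j = l
    · subst hj; simp
    · simp [hj]
  have e1 : b + Pi.single i 1 + Pi.single k 1 - Pi.single i 1 = b + Pi.single k 1 := by abel
  have e2 : b + Pi.single i 1 + Pi.single k 1 - Pi.single k 1 = b + Pi.single i 1 := by abel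
  have e3 : (b + Pi.single i 1 + Pi.single k 1 : _ → ℝ) i = b i + 1 := by simp [hik]
  have e4 : (b + Pi.single i 1 + Pi.single k 1 : _ → ℝ) k = b k + 1 := by simp [hik.symm]
  rw [e1, e2, e3, e4, hcast, hcast, hcast, hcast] at hparts
  change _ = -((z i - z k : ℝ) * simplexIntegral (deriv h)
    (β + Pi.single i 1 + Pi.single k 1) z) at hparts
  have r1 : ∀ (g : ℝ → ℂ) c, reducedAverage g c z =
    (∏ j, (Complex.Gamma (c j))⁻¹) * simplexIntegral g c z := fun _ _ => rfl
  rw [r1, r1, r1, prod_inv_Gamma_add_single (hne i), prod_inv_Gamma_add_single (hne k),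
    prod_inv_Gamma_add_single hne', prod_inv_Gamma_add_single (hne i)]
  have e5 : (β + Pi.single i 1 : _ → ℂ) k = β k := by simp [hik.symm]
  rw [e5]
  have hi := hne i
  have hk := hne k
  push_cast at hparts ⊢
  simp only [add_sub_cancel_right] at hparts
  change β i * simplexIntegral h (β + Pi.single k 1) z -
    β k * simplexIntegral h (β + Pi.single i 1) z = _ at hparts
  generalize ∏ j, (Complex.Gamma (β j))⁻¹ = G
  field_simp
  linear_combination -G * hparts

/-- The recurrence which expresses an average with parameters `b` through averages, of `h` and its
derivative, in which the parameter `b_k` is raised. -/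
theorem reducedAverage_recurrence {h : ℝ → ℂ} (hh : ContDiff ℝ 1 h) {b : Fin (m + 1) → ℝ}
    (hb : ∀ j, 2 < b j) (z : Fin (m + 1) → ℝ) (k : Fin (m + 1)) :
    reducedAverage h (fun j => (b j : ℂ)) z =
      (∑ i, (b i : ℂ)) * reducedAverage h ((fun j => (b j : ℂ)) + Pi.single k 1) z +
        ∑ i, (b i : ℂ) * ((z i - z k : ℝ) * reducedAverage (deriv h)
          ((fun j => (b j : ℂ)) + Pi.single i 1 + Pi.single k 1) z) := by
  rw [reducedAverage_eq_sum hh.continuous fun j => by simpa using zero_lt_two.trans (hb j),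
    Finset.sum_mul, ← Finset.sum_add_distrib]
  refine Finset.sum_congr rfl fun i _ => ?_
  rw [← reducedAverage_add_single_sub hh hb z i k]
  ring

end Recurrence

/-! ### Continuation to all regular parameters for smooth h -/

section Continuation

variable {m : ℕ}

/-- `F` continues the reduced averages of `h` holomorphically to the parameter vectors in
`V`, jointly continuously in the parameters and the nodes. -/
structure IsJointContinuation (V : Set (Fin (m + 1) → ℂ)) (Z : Set (Fin (m + 1) → ℝ))
    (h : ℝ → ℂ) (F : (Fin (m + 1) → ℂ) → (Fin (m + 1) → ℝ) → ℂ) : Prop where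
  differentiableOn : ∀ z ∈ Z, DifferentiableOn ℂ (fun b => F b z) V
  continuousOn : ContinuousOn (fun p : (Fin (m + 1) → ℂ) × (Fin (m + 1) → ℝ) => F p.1 p.2) (V ×ˢ Z)
  eq_reducedAverage : ∀ z ∈ Z, ∀ b : Fin (m + 1) → ℝ, (∀ i, 0 < b i) →
    F (fun i => (b i : ℂ)) z = reducedAverage h (fun i => (b i : ℂ)) z

theorem isJointContinuation_reducedAverage {h : ℝ → ℂ} (hh : Continuous h) :
    IsJointContinuation (paramHalfSpace m 0) univ h (reducedAverage h) :=
  ⟨fun z _ => differentiableOn_reducedAverage hh z, continuousOn_reducedAverage hh,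
    fun _ _ _ _ => rfl⟩

theorem paramHalfSpace_mono {T T' : Fin (m + 1) → ℝ} (hT : T ≤ T') :
    paramHalfSpace m T ⊆ paramHalfSpace m T' := fun _ hb i =>
  (neg_le_neg (hT i)).trans_lt (hb i)

theorem ofReal_add_single (b : Fin (m + 1) → ℝ) (k : Fin (m + 1)) :
    (fun i => (b i : ℂ)) + Pi.single k 1 = fun i => ((b + Pi.single k 1 : _ → ℝ) i : ℂ) := by
  ext j
  by_cases hj : j = k
  · subst hj; simp
  · simp [hj]

theorem add_single_pos {b : Fin (m + 1) → ℝ} (hb : ∀ i, 0 < b i) (k i : Fin (m + 1)) :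
    0 < (b + Pi.single k 1 : _ → ℝ) i :=
  add_pos_of_pos_of_nonneg (hb i)
    ((Pi.single_nonneg.2 zero_le_one : (0 : Fin (m + 1) → ℝ) ≤ Pi.single k 1) i)

theorem add_single_mem_of_mem_raise {T : Fin (m + 1) → ℝ} {k : Fin (m + 1)}
    {b : Fin (m + 1) → ℂ} (hb : b ∈ paramHalfSpace m (T + Pi.single k 1)) :
    b + Pi.single k 1 ∈ paramHalfSpace m T := fun j => by
  have := hb j
  by_cases hj : j = k
  · subst hj
    simp at this ⊢
    linarith
  · simpa [hj] using this

/-- One application of the recurrence continues the averages across a hyperplane. -/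
theorem IsJointContinuation.raise {T : Fin (m + 1) → ℝ} (hT : 0 ≤ T) {h : ℝ → ℂ}
    (hh : ContDiff ℝ 1 h) {F F' : (Fin (m + 1) → ℂ) → (Fin (m + 1) → ℝ) → ℂ}
    (hF : IsJointContinuation (paramHalfSpace m T) univ h F)
    (hF' : IsJointContinuation (paramHalfSpace m T) univ (deriv h) F') (k : Fin (m + 1)) :
    IsJointContinuation (paramHalfSpace m (T + Pi.single k 1)) univ h fun b z =>
      (∑ i, b i) * F (b + Pi.single k 1) z +
        ∑ i, b i * ((z i - z k : ℝ) * F' (b + Pi.single i 1 + Pi.single k 1) z) := by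
  have hmem2 : ∀ b ∈ paramHalfSpace m (T + Pi.single k 1), ∀ i,
      b + Pi.single i 1 + Pi.single k 1 ∈ paramHalfSpace m T := fun b hb i =>
    add_single_mem_of_mem_raise (add_single_mem_paramHalfSpace hb i)
  have hdiff : ∀ z, DifferentiableOn ℂ (fun b : Fin (m + 1) → ℂ =>
      (∑ i, b i) * F (b + Pi.single k 1) z +
        ∑ i, b i * ((z i - z k : ℝ) * F' (b + Pi.single i 1 + Pi.single k 1) z))
      (paramHalfSpace m (T + Pi.single k 1)) := by
    intro z
    have h1 := (hF.differentiableOn z trivial).comp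
      (f := fun b : Fin (m + 1) → ℂ => b + Pi.single k 1)
      (s := paramHalfSpace m (T + Pi.single k 1)) (by fun_prop)
      fun b hb => add_single_mem_of_mem_raise hb
    have h2 : ∀ i, DifferentiableOn ℂ _ _ := fun i => (hF'.differentiableOn z trivial).comp
      (f := fun b : Fin (m + 1) → ℂ => b + Pi.single i 1 + Pi.single k 1)
      (s := paramHalfSpace m (T + Pi.single k 1)) (by fun_prop) fun b hb => hmem2 b hb i
    refine (DifferentiableOn.mul (by fun_prop) h1).add (DifferentiableOn.fun_sum fun i _ => ?_)
    exact DifferentiableOn.mul (by fun_prop) ((h2 i).const_mul _)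
  refine ⟨fun z _ => hdiff z, ?_, ?_⟩
  · have h1 : ContinuousOn _ _ := hF.continuousOn.comp
      (f := fun p : (Fin (m + 1) → ℂ) × (Fin (m + 1) → ℝ) => (p.1 + Pi.single k 1, p.2))
      (s := paramHalfSpace m (T + Pi.single k 1) ×ˢ univ) (by fun_prop)
      fun p hp => ⟨add_single_mem_of_mem_raise hp.1, trivial⟩
    have h2 : ∀ i, ContinuousOn _ _ := fun i => hF'.continuousOn.comp
      (f := fun p : (Fin (m + 1) → ℂ) × (Fin (m + 1) → ℝ) =>
        (p.1 + Pi.single i 1 + Pi.single k 1, p.2))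
      (s := paramHalfSpace m (T + Pi.single k 1) ×ˢ univ) (by fun_prop)
      fun p hp => ⟨hmem2 p.1 hp.1 i, trivial⟩
    refine (ContinuousOn.mul (by fun_prop) h1).add (continuousOn_finsetSum _ fun i _ => ?_)
    exact ContinuousOn.mul (by fun_prop) (ContinuousOn.mul (by fun_prop) (h2 i))
  · intro z _ b hb
    -- The recurrence is proved only for b_j > 2, so it is used near (3, …, 3) and the identity
    -- theorem carries the agreement to all positive b.
    refine eqOn_of_eventually_eq_real (V := paramHalfSpace m 0) (isOpen_paramHalfSpace 0)
      (convex_paramHalfSpace 0).isPreconnected ((hdiff z).mono (paramHalfSpace_mono ?_))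
      (differentiableOn_reducedAverage hh.continuous z) (b₀ := fun _ => 3) ?_ ?_ ?_
    · exact add_nonneg hT (Pi.single_nonneg.2 zero_le_one)
    · intro i; simp
    · have : ∀ᶠ b : Fin (m + 1) → ℝ in 𝓝 fun _ => 3, ∀ i, 2 < b i :=
        eventually_all.2 fun i => (continuous_apply i).continuousAt.eventually
          (lt_mem_nhds (by norm_num : (2 : ℝ) < 3))
      filter_upwards [this] with b hb
      have hpos : ∀ i, 0 < b i := fun i => zero_lt_two.trans (hb i)
      simp only [reducedAverage_recurrence hh hb z k, ofReal_add_single]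
      rw [hF.eq_reducedAverage z trivial _ (add_single_pos hpos k)]
      congr 1
      refine Finset.sum_congr rfl fun i _ => ?_
      rw [hF'.eq_reducedAverage z trivial _ (add_single_pos (add_single_pos hpos i) k)]
    · intro i; simpa using hb i

/-- The averages of functions of some smoothness continue to the half space of `T`. -/
def HasContinuations (T : Fin (m + 1) → ℝ) : Prop :=
  ∃ p : ℕ, ∀ h : ℝ → ℂ, ContDiff ℝ p h →
    ∃ F, IsJointContinuation (paramHalfSpace m T) univ h F

theorem HasContinuations.raise {T : Fin (m + 1) → ℝ} (hT : 0 ≤ T) (hc : HasContinuations T)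
    (k : Fin (m + 1)) : HasContinuations (T + Pi.single k 1) := by
  obtain ⟨p, hp⟩ := hc
  refine ⟨p + 1, fun h hh => ?_⟩
  push_cast at hh
  obtain ⟨F, hF⟩ := hp h (hh.of_le le_self_add)
  obtain ⟨F', hF'⟩ := hp (deriv h) (contDiff_succ_iff_deriv.1 hh).2.2
  exact ⟨_, hF.raise hT (hh.of_le le_add_self) hF' k⟩

/-- Passing from N to N + 1 raises the coordinates one after another, and each raise asks for one
more derivative of h. -/
theorem hasContinuations_nat (N : ℕ) : HasContinuations fun _ : Fin (m + 1) => (N : ℝ) := by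
  induction N with
  | zero =>
    refine ⟨0, fun h hh => ⟨reducedAverage h, ?_⟩⟩
    have := isJointContinuation_reducedAverage (m := m) hh.continuous
    rwa [show (fun _ : Fin (m + 1) => ((0 : ℕ) : ℝ)) = 0 from funext fun _ => Nat.cast_zero]
  | succ N ih =>
    have key : ∀ s : Finset (Fin (m + 1)),
        HasContinuations ((fun _ => (N : ℝ)) + ∑ k ∈ s, (Pi.single k 1 : Fin (m + 1) → ℝ)) := by
      intro s
      induction s using Finset.induction_on with
      | empty => simpa using ih
      | insert k s hk ihs =>
        rw [Finset.sum_insert hk, add_comm (Pi.single k 1), ← add_assoc]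
        refine ihs.raise (add_nonneg (fun _ => Nat.cast_nonneg N) ?_) k
        exact Finset.sum_nonneg fun k _ => Pi.single_nonneg.2 zero_le_one
    convert key Finset.univ using 1
    rw [Finset.univ_sum_single (fun _ : Fin (m + 1) => (1 : ℝ))]
    funext i
    simp

/-- A smooth function on a compact interval extends to the line with any finite smoothness. -/
theorem exists_contDiff_extension {a c : ℝ} (hac : a < c) (N : ℕ) :
    ∀ {h : ℝ → ℂ}, ContDiffOn ℝ ∞ h (Icc a c) → ∃ g : ℝ → ℂ, ContDiff ℝ N g ∧
      EqOn g h (Icc a c) := by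
  induction N with
  | zero =>
    intro h hh
    refine ⟨IccExtend hac.le ((Icc a c).domRestrict h), ?_, fun x hx => ?_⟩
    · rw [Nat.cast_zero, contDiff_zero]
      exact hh.continuousOn.domRestrict.Icc_extend'
    · rw [IccExtend_of_mem _ _ hx, domRestrict_apply]
  | succ N ih =>
    intro h hh
    have hu := uniqueDiffOn_Icc hac
    -- Extend the derivative with one order of smoothness less, then integrate it from a.
    obtain ⟨g, hg, hgh⟩ := ih (hh.derivWithin hu (m := ∞) le_rfl)
    have hd : ∀ x, HasDerivAt (fun x => h a + ∫ t in a..x, g t) (g x) x := fun x =>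
      (intervalIntegral.integral_hasDerivAt_right (hg.continuous.intervalIntegrable _ _)
        hg.continuous.stronglyMeasurable.stronglyMeasurableAtFilter
        hg.continuous.continuousAt).const_add _
    refine ⟨fun x => h a + ∫ t in a..x, g t, ?_, ?_⟩
    · push_cast
      refine contDiff_succ_iff_deriv.2 ⟨fun x => (hd x).differentiableAt, by simp, ?_⟩
      rwa [show deriv (fun x => h a + ∫ t in a..x, g t) = g from funext fun x => (hd x).deriv]
    · refine eq_of_derivWithin_eq (fun x _ => (hd x).differentiableAt.differentiableWithinAt)
        (hh.differentiableOn (by simp)) (fun x hx => ?_) (by simp)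
      rw [(hd x).hasDerivWithinAt.derivWithin (hu x (Ico_subset_Icc_self hx)),
        hgh (Ico_subset_Icc_self hx)]

theorem sum_baryWeights_mul_mem_Icc {a c : ℝ} {z : Fin (m + 1) → ℝ}
    (hz : z ∈ univ.pi fun _ => Icc a c) {t : Fin m → ℝ} (ht : t ∈ stdSimplexE m) :
    ∑ i, baryWeights t i * z i ∈ Icc a c := by
  have := (convex_Icc a c).sum_mem (t := Finset.univ) (w := fun i => baryWeights t i) (z := z)
    (fun i _ => mem_stdSimplexE_iff.1 ht i) (sum_baryWeights t) fun i _ => hz i trivial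
  simpa using this

theorem reducedAverage_congr {a c : ℝ} {g h : ℝ → ℂ} (hgh : EqOn g h (Icc a c))
    {z : Fin (m + 1) → ℝ} (hz : z ∈ univ.pi fun _ => Icc a c) (b : Fin (m + 1) → ℂ) :
    reducedAverage g b z = reducedAverage h b z := by
  unfold reducedAverage
  congr 1
  refine setIntegral_congr_fun measurableSet_stdSimplexE fun t ht => ?_
  simp only [hgh (sum_baryWeights_mul_mem_Icc hz ht)]

/-- The reduced averages of a smooth function are entire in the parameters. -/
theorem exists_isJointContinuation_univ {a c : ℝ} (hac : a < c) {h : ℝ → ℂ}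
    (hh : ContDiffOn ℝ ∞ h (Icc a c)) :
    ∃ F, IsJointContinuation (m := m) univ (univ.pi fun _ => Icc a c) h F := by
  set Z : Set (Fin (m + 1) → ℝ) := univ.pi fun _ => Icc a c with hZ
  let S : ℕ → Set (Fin (m + 1) → ℂ) := fun N => paramHalfSpace m fun _ => (N : ℝ)
  have hex : ∀ N, ∃ F, IsJointContinuation (S N) Z h F := by
    intro N
    obtain ⟨p, hp⟩ := hasContinuations_nat (m := m) N
    -- The extension may depend on N: averages with nodes in Z see only the values of h on the
    -- interval.
    obtain ⟨g, hg, hgh⟩ := exists_contDiff_extension hac p hh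
    obtain ⟨F, hF⟩ := hp g hg
    refine ⟨F, fun z _ => hF.differentiableOn z trivial,
      hF.continuousOn.mono (prod_mono_right (subset_univ _)), fun z hz b hb => ?_⟩
    rw [hF.eq_reducedAverage z trivial b hb, reducedAverage_congr hgh hz]
  choose F hF using hex
  have hSmono : ∀ {N N'}, N ≤ N' → S N ⊆ S N' := fun hN =>
    paramHalfSpace_mono fun _ => Nat.cast_le.2 hN
  have hle : ∀ {N N'}, N ≤ N' → ∀ b ∈ S N, ∀ z ∈ Z, F N b z = F N' b z := by
    intro N N' hN b hb z hz
    exact IsAnalyticContinuation.eqOn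
      (isContinuationRegion_paramHalfSpace fun _ => Nat.cast_nonneg N)
      ⟨(hF N).differentiableOn z hz, (hF N).eq_reducedAverage z hz⟩
      ⟨((hF N').differentiableOn z hz).mono (hSmono hN), (hF N').eq_reducedAverage z hz⟩ hb
  -- The added 1 turns Re b_i ≥ −⌈‖b‖⌉ into the strict inequality that the half space requires.
  have hmem : ∀ b : Fin (m + 1) → ℂ, b ∈ S (⌈‖b‖⌉₊ + 1) := fun b i => by
    have h1 := (abs_le.1 ((Complex.abs_re_le_norm (b i)).trans (norm_le_pi_norm b i))).1
    have h2 := Nat.le_ceil ‖b‖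
    push_cast
    linarith
  have heq : ∀ N, ∀ b ∈ S N, ∀ z ∈ Z, F (⌈‖b‖⌉₊ + 1) b z = F N b z := by
    intro N b hb z hz
    rcases le_total N (⌈‖b‖⌉₊ + 1) with hN | hN
    · exact (hle hN b hb z hz).symm
    · exact hle hN b (hmem b) z hz
  have hopen : ∀ N, IsOpen (S N) := fun N => isOpen_paramHalfSpace _
  -- The index jumps with b, but uniqueness of continuations makes the glued function equal to a
  -- single `F N` near each point.
  refine ⟨fun b z => F (⌈‖b‖⌉₊ + 1) b z, fun z hz b _ => ?_, ?_, fun z hz b hb => ?_⟩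
  · have hnhds := (hopen _).mem_nhds (hmem b)
    refine DifferentiableAt.differentiableWithinAt ?_
    refine (((hF _).differentiableOn z hz).differentiableAt hnhds).congr_of_eventuallyEq ?_
    filter_upwards [hnhds] with b' hb'
    exact heq _ b' hb' z hz
  · rintro ⟨b, z⟩ ⟨-, hz⟩
    have h1 := (hF (⌈‖b‖⌉₊ + 1)).continuousOn (b, z) ⟨hmem b, hz⟩
    have hnhds : S (⌈‖b‖⌉₊ + 1) ×ˢ Z ∈ 𝓝[univ ×ˢ Z] (b, z) := by
      have h2 : S (⌈‖b‖⌉₊ + 1) ×ˢ (univ : Set (Fin (m + 1) → ℝ)) ∈ 𝓝 (b, z) :=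
        prod_mem_nhds ((hopen _).mem_nhds (hmem b)) univ_mem
      filter_upwards [mem_nhdsWithin_of_mem_nhds h2, self_mem_nhdsWithin] with p hp hp'
      exact ⟨hp.1, hp'.2⟩
    refine (h1.mono_of_mem_nhdsWithin hnhds).congr_of_eventuallyEq ?_ rfl
    filter_upwards [hnhds] with p hp
    exact heq _ p.1 hp.1 p.2 hp.2
  · rw [(hF _).eq_reducedAverage z hz b hb]

/-- The Dirichlet averages of a smooth function continue to `regularParams`, jointly continuously
in the parameters and the nodes. -/
theorem exists_continuation_dirichletAverage {a c : ℝ} (hac : a < c) {h : ℝ → ℂ}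
    (hh : ContDiffOn ℝ ∞ h (Icc a c)) :
    ∃ H : (Fin (m + 1) → ℂ) → (Fin (m + 1) → ℝ) → ℂ,
      (∀ z ∈ univ.pi fun _ => Icc a c, IsAnalyticContinuation (regularParams (m + 1))
        (fun b => dirichletAverage h b z) fun b => H b z) ∧
      ContinuousOn (fun p : (Fin (m + 1) → ℂ) × (Fin (m + 1) → ℝ) => H p.1 p.2)
        (regularParams (m + 1) ×ˢ univ.pi fun _ => Icc a c) := by
  obtain ⟨F, hF⟩ := exists_isJointContinuation_univ (m := m) hac hh
  have hG : DifferentiableOn ℂ (fun b : Fin (m + 1) → ℂ => Complex.Gamma (∑ i, b i))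
      (regularParams (m + 1)) := fun b hb => by
    have h1 : DifferentiableAt ℂ (fun b : Fin (m + 1) → ℂ => ∑ i, b i) b := by fun_prop
    exact ((Complex.differentiableAt_Gamma _ hb).comp b h1).differentiableWithinAt
  refine ⟨fun b z => Complex.Gamma (∑ i, b i) * F b z, fun z hz => ⟨?_, fun b hb => ?_⟩, ?_⟩
  · exact hG.mul ((hF.differentiableOn z hz).mono (subset_univ _))
  · simp only [dirichletAverage_eq, hF.eq_reducedAverage z hz b hb]
  · exact (hG.continuousOn.comp continuousOn_fst fun p hp => hp.1).mul
      (hF.continuousOn.mono (prod_mono_left (subset_univ _)))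

end Continuation

/-! ### The Dirichlet spline as a Radon–Nikodym density -/

section Spline

variable {n s : ℕ}

/-- The affine map `t ↦ ∑ t_j x^j` from `ℝ^n` to `ℝ^s`. -/
def baryMap (X : Fin (n + 1) → Fin s → ℝ) (t : Fin n → ℝ) : Fin s → ℝ :=
  ∑ j, baryWeights t j • X j

theorem continuous_baryMap (X : Fin (n + 1) → Fin s → ℝ) : Continuous (baryMap X) :=
  continuous_finsetSum _ fun j _ => (continuous_baryWeights j).smul continuous_const

theorem baryMap_mem_convexHull (X : Fin (n + 1) → Fin s → ℝ) {t : Fin n → ℝ}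
    (ht : t ∈ stdSimplexE n) : baryMap X t ∈ convexHull ℝ (range X) :=
  (convex_convexHull ℝ _).sum_mem (fun j _ => mem_stdSimplexE_iff.1 ht j) (sum_baryWeights t)
    fun j _ => subset_convexHull ℝ _ (mem_range_self j)

/-- The linear part of `baryMap X`. -/
def baryLinear (X : Fin (n + 1) → Fin s → ℝ) : (Fin n → ℝ) →ₗ[ℝ] (Fin s → ℝ) :=
  ∑ j, (LinearMap.proj j).smulRight (X j.succ - X 0)

theorem baryLinear_apply (X : Fin (n + 1) → Fin s → ℝ) (t : Fin n → ℝ) :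
    baryLinear X t = ∑ j, t j • (X j.succ - X 0) := by
  simp [baryLinear, LinearMap.sum_apply]

theorem baryMap_eq (X : Fin (n + 1) → Fin s → ℝ) (t : Fin n → ℝ) :
    baryMap X t = X 0 + baryLinear X t := by
  rw [baryMap, baryLinear_apply, Fin.sum_univ_succ]
  simp only [baryWeights_zero, baryWeights_succ, smul_sub, Finset.sum_sub_distrib, sub_smul,
    one_smul, Finset.sum_smul]
  abel

/-- Otherwise the hull would lie in a translate of a proper subspace, which is null. -/
theorem surjective_baryLinear {X : Fin (n + 1) → Fin s → ℝ}
    (hX : 0 < volume (convexHull ℝ (range X))) : Function.Surjective (baryLinear X) := by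
  rw [← LinearMap.range_eq_top]
  by_contra hne
  have h1 : volume ((LinearMap.range (baryLinear X) : Submodule ℝ (Fin s → ℝ)) :
      Set (Fin s → ℝ)) = 0 := Measure.addHaar_submodule volume _ hne
  have hsub : convexHull ℝ (range X) ⊆
      (fun y => -X 0 + y) ⁻¹' (LinearMap.range (baryLinear X) : Set (Fin s → ℝ)) := by
    refine convexHull_min ?_ ?_
    · rintro _ ⟨j, rfl⟩
      refine Fin.cases ⟨0, by simp⟩ (fun j => ⟨Pi.single j 1, ?_⟩) j
      rw [baryLinear_apply, Finset.sum_eq_single j (fun i _ hi => by simp [hi]) (by simp)]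
      simp
      abel
    · exact (Submodule.convex _).translate_preimage_right _
  have h2 := measure_mono (μ := volume) hsub
  rw [measure_preimage_add, h1] at h2
  exact absurd h2 (not_le.2 hX)

theorem map_baryMap_absolutelyContinuous {X : Fin (n + 1) → Fin s → ℝ}
    (hX : 0 < volume (convexHull ℝ (range X))) :
    Measure.map (baryMap X) volume ≪ (volume : Measure (Fin s → ℝ)) := by
  refine Measure.AbsolutelyContinuous.mk fun A hA hA0 => ?_
  rw [Measure.map_apply (continuous_baryMap X).measurable hA]
  have hA' : MeasurableSet ((fun y => X 0 + y) ⁻¹' A) := measurable_const_add _ hA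
  have h0 : volume ((fun y => X 0 + y) ⁻¹' A) = 0 := by rwa [measure_preimage_add]
  have key := (ae_comp_linearMap_mem_iff (baryLinear X) volume volume
    (surjective_baryLinear hX) hA'.compl).2 (measure_eq_zero_iff_ae_notMem.1 h0)
  refine measure_eq_zero_iff_ae_notMem.2 ?_
  filter_upwards [key] with t ht hmem
  exact ht (by simpa [baryMap_eq] using hmem)

theorem measurable_dirichletDensity (d : Fin (n + 1) → ℝ) : Measurable (dirichletDensity d) := by
  refine measurable_const.mul (Finset.measurable_fun_prod _ fun i _ => ?_)
  exact measurable_const.mul ((continuous_baryWeights i).measurable.pow_const _)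

/-- The distribution of `∑ t_j x^j` for a Dirichlet distributed `t`. -/
noncomputable def dirichletImage (d : Fin (n + 1) → ℝ) (X : Fin (n + 1) → Fin s → ℝ) :
    Measure (Fin s → ℝ) :=
  Measure.map (baryMap X) ((volume.restrict (stdSimplexE n)).withDensity
    fun t => ENNReal.ofReal (dirichletDensity d t))

variable {d : Fin (n + 1) → ℝ} {X : Fin (n + 1) → Fin s → ℝ}

theorem isFiniteMeasure_dirichletImage (hd : ∀ j, 0 < d j) :
    IsFiniteMeasure (dirichletImage d X) := by
  have := isFiniteMeasure_withDensity_ofReal (integrableOn_dirichletDensity hd).2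
  exact Measure.isFiniteMeasure_map _ _

theorem dirichletImage_absolutelyContinuous (hX : 0 < volume (convexHull ℝ (range X))) :
    dirichletImage d X ≪ volume :=
  (((withDensity_absolutelyContinuous _ _).trans Measure.restrict_le_self.absolutelyContinuous).map
    (continuous_baryMap X).measurable).trans (map_baryMap_absolutelyContinuous hX)

theorem integral_dirichletImage (hd : ∀ j, 0 < d j) {E : Type*} [NormedAddCommGroup E]
    [NormedSpace ℝ E] {g : (Fin s → ℝ) → E}
    (hg : AEStronglyMeasurable g (dirichletImage d X)) :
    ∫ x, g x ∂(dirichletImage d X) =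
      ∫ t in stdSimplexE n, dirichletDensity d t • g (baryMap X t) := by
  rw [dirichletImage, integral_map (continuous_baryMap X).aemeasurable hg,
    integral_withDensity_eq_integral_toReal_smul
      (measurable_dirichletDensity d).ennreal_ofReal (by simp)]
  refine setIntegral_congr_fun measurableSet_stdSimplexE fun t ht => ?_
  simp only [ENNReal.toReal_ofReal (dirichletDensity_nonneg hd ht)]

/-- The image law is finite and absolutely continuous, so its density is integrable and change of
variables gives the defining identity. -/
theorem isDirichletSpline_rnDeriv (hX : 0 < volume (convexHull ℝ (range X)))
    (hd : ∀ j, 0 < d j) :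
    IsDirichletSpline d X fun x => ((dirichletImage d X).rnDeriv volume x).toReal := by
  have := isFiniteMeasure_dirichletImage (X := X) hd
  refine ⟨Measure.integrable_toReal_rnDeriv.locallyIntegrable, fun f hf _ => ?_⟩
  simp only [mul_comm (f _)]
  rw [integral_toReal_rnDeriv_mul (dirichletImage_absolutelyContinuous hX),
    integral_dirichletImage hd hf.aestronglyMeasurable]
  simp only [smul_eq_mul, baryMap]

/-- Smooth test functions of compact support already separate locally integrable functions. -/
theorem IsDirichletSpline.ae_eq {M M' : (Fin s → ℝ) → ℝ} (hM : IsDirichletSpline d X M)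
    (hM' : IsDirichletSpline d X M') : M =ᵐ[volume] M' :=
  ae_eq_of_integral_contDiff_smul_eq hM.1 hM'.1 fun g hg hgs => by
    simp only [smul_eq_mul]
    rw [hM.2 g hg.continuous hgs, hM'.2 g hg.continuous hgs]

theorem isCompact_convexHull_range (X : Fin (n + 1) → Fin s → ℝ) :
    IsCompact (convexHull ℝ (range X)) :=
  (finite_range X).isCompact_convexHull ℝ

theorem IsDirichletSpline.integrableOn_mul {M : (Fin s → ℝ) → ℝ} (hM : IsDirichletSpline d X M)
    {g : (Fin s → ℝ) → ℂ} (hg : ContinuousOn g (convexHull ℝ (range X))) :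
    IntegrableOn (fun x => (M x : ℂ) * g x) (convexHull ℝ (range X)) := by
  have hK := isCompact_convexHull_range X
  have h1 : IntegrableOn (fun x => (M x : ℂ)) (convexHull ℝ (range X)) :=
    (hM.1.integrableOn_isCompact hK).ofReal
  exact h1.mul_continuousOn hg hK

/-- Integration of continuous functions against a Dirichlet spline. -/
theorem IsDirichletSpline.setIntegral_mul (hX : 0 < volume (convexHull ℝ (range X)))
    (hd : ∀ j, 0 < d j) {M : (Fin s → ℝ) → ℝ} (hM : IsDirichletSpline d X M)
    {g : (Fin s → ℝ) → ℂ} (hg : ContinuousOn g (convexHull ℝ (range X))) :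
    ∫ x in convexHull ℝ (range X), (M x : ℂ) * g x =
      ∫ t in stdSimplexE n, g (baryMap X t) * (dirichletDensity d t : ℂ) := by
  have := isFiniteMeasure_dirichletImage (X := X) hd
  have hK := (isCompact_convexHull_range X).measurableSet
  have hgm : AEStronglyMeasurable ((convexHull ℝ (range X)).indicator g) (dirichletImage d X) :=
    (aestronglyMeasurable_indicator_iff hK).2 (hg.aestronglyMeasurable hK)
  -- Replace M by the density. The indicator makes g globally measurable and costs nothing, since Xt
  -- lies in the hull for t in the simplex.
  have h1 : ∫ x in convexHull ℝ (range X), (M x : ℂ) * g x =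
      ∫ x, ((dirichletImage d X).rnDeriv volume x).toReal •
        (convexHull ℝ (range X)).indicator g x := by
    rw [← integral_indicator hK]
    refine integral_congr_ae ?_
    filter_upwards [hM.ae_eq (isDirichletSpline_rnDeriv hX hd)] with x hx
    by_cases hxK : x ∈ convexHull ℝ (range X)
    · simp [hxK, hx]
    · simp [hxK]
  rw [h1, integral_rnDeriv_smul (dirichletImage_absolutelyContinuous hX),
    integral_dirichletImage hd hgm]
  refine setIntegral_congr_fun measurableSet_stdSimplexE fun t ht => ?_
  simp [baryMap_mem_convexHull X ht, mul_comm]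

end Spline

/-! ### The identity for single and double averages -/

section Main

variable {n r : ℕ} {X : Fin (n + 1) → Fin (r + 1) → ℝ} {d : Fin (n + 1) → ℝ}

theorem convexHull_range_subset_pi_Icc (X : Fin (n + 1) → Fin (r + 1) → ℝ) :
    convexHull ℝ (range X) ⊆
      univ.pi fun _ => Icc (⨅ j, ⨅ i, X j i) (⨆ j, ⨆ i, X j i) := by
  refine convexHull_min ?_ (convex_pi fun _ _ => convex_Icc _ _)
  rintro _ ⟨j, rfl⟩ i -
  exact ⟨(ciInf_le (finite_range _).bddBelow j).trans (ciInf_le (finite_range _).bddBelow i),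
    (le_ciSup (f := fun i => X j i) (finite_range _).bddAbove i).trans
      (le_ciSup (f := fun j => ⨆ i, X j i) (finite_range _).bddAbove j)⟩

theorem iInf_lt_iSup_of_volume_pos (hX : 0 < volume (convexHull ℝ (range X))) :
    ⨅ j, ⨅ i, X j i < ⨆ j, ⨆ i, X j i := by
  by_contra hle
  have h1 := measure_mono (μ := volume) (convexHull_range_subset_pi_Icc X)
  rw [volume_pi_pi, Finset.prod_eq_zero (Finset.mem_univ 0)] at h1
  · exact absurd h1 (not_le.2 hX)
  · rw [Real.volume_Icc, ENNReal.ofReal_eq_zero]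
    linarith

theorem continuousOn_dirichletAverage {h : ℝ → ℂ} (hh : ContinuousOn h (entryInterval X))
    (hX : 0 < volume (convexHull ℝ (range X))) {b : Fin (r + 1) → ℝ} (hb : ∀ i, 0 < b i) :
    ContinuousOn (dirichletAverage h b) (convexHull ℝ (range X)) := by
  have hac := (iInf_lt_iSup_of_volume_pos hX).le
  -- Constant extension beyond the endpoints, since the continuity result needs h continuous on the
  -- whole line.
  set g : ℝ → ℂ := IccExtend hac ((Icc _ _).domRestrict h) with hg
  have hgc : Continuous g := hh.domRestrict.Icc_extend'
  have hgh : EqOn g h (Icc (⨅ j, ⨅ i, X j i) (⨆ j, ⨆ i, X j i)) := fun x hx => by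
    rw [hg, IccExtend_of_mem _ _ hx, domRestrict_apply]
  have h1 : ContinuousOn (fun z => reducedAverage g (fun i => (b i : ℂ)) z)
      (convexHull ℝ (range X)) :=
    (continuousOn_reducedAverage hgc).comp (f := fun z => ((fun i => (b i : ℂ)), z))
      (by fun_prop) fun z _ => ⟨fun i => by simpa using hb i, trivial⟩
  refine ((continuousOn_const (c := Complex.Gamma (∑ i, (b i : ℂ)))).mul h1).congr
    fun z hz => ?_
  rw [dirichletAverage_eq, ← reducedAverage_congr hgh
    (convexHull_range_subset_pi_Icc X hz)]
  rfl

/-- Regrouping u · Xv as ∑ u_i (Xv)_i exhibits the inner integral as a single average with node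
vector Xv. -/
theorem doubleDirichletAverage_eq (h : ℝ → ℂ) (b : Fin (r + 1) → ℝ)
    (X : Fin (n + 1) → Fin (r + 1) → ℝ) (d : Fin (n + 1) → ℝ) :
    doubleDirichletAverage h b X d = ∫ v in stdSimplexE n,
      dirichletAverage h b (baryMap X v) * (dirichletDensity d v : ℂ) := by
  have hsum : ∀ (u : Fin r → ℝ) (v : Fin n → ℝ),
      ∑ i, ∑ j, baryWeights u i * X j i * baryWeights v j =
        ∑ i, baryWeights u i * baryMap X v i := fun u v => by
    refine Finset.sum_congr rfl fun i _ => ?_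
    simp only [baryMap, Finset.sum_apply, Pi.smul_apply, smul_eq_mul, Finset.mul_sum]
    exact Finset.sum_congr rfl fun j _ => by ring
  simp only [doubleDirichletAverage, dirichletAverage, hsum]
  congr 1
  funext v
  rw [integral_mul_const]

/-- The identity between single and double averages for positive parameters. -/
theorem doubleDirichletAverage_eq_setIntegral (hX : 0 < volume (convexHull ℝ (range X)))
    (hd : ∀ j, 0 < d j) {h : ℝ → ℂ} (hh : ContinuousOn h (entryInterval X))
    {M : (Fin (r + 1) → ℝ) → ℝ} (hM : IsDirichletSpline d X M) {b : Fin (r + 1) → ℝ}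
    (hb : ∀ i, 0 < b i) :
    doubleDirichletAverage h b X d =
      ∫ x in convexHull ℝ (range X), (M x : ℂ) * dirichletAverage h b x := by
  rw [hM.setIntegral_mul hX hd (continuousOn_dirichletAverage hh hX hb),
    doubleDirichletAverage_eq]

theorem continuousOn_section {V : Set (Fin (r + 1) → ℂ)} {K : Set (Fin (r + 1) → ℝ)}
    {H : (Fin (r + 1) → ℂ) → (Fin (r + 1) → ℝ) → ℂ}
    (hc : ContinuousOn (fun p : (Fin (r + 1) → ℂ) × (Fin (r + 1) → ℝ) => H p.1 p.2) (V ×ˢ K))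
    {b : Fin (r + 1) → ℂ} (hb : b ∈ V) : ContinuousOn (H b) K :=
  hc.comp (f := fun x => (b, x)) (by fun_prop) fun _ hx => ⟨hb, hx⟩

/-- Integrating a continuation of the single averages against the spline continues the double
average. -/
theorem isAnalyticContinuation_setIntegral (hX : 0 < volume (convexHull ℝ (range X)))
    (hd : ∀ j, 0 < d j) {h : ℝ → ℂ} (hh : ContinuousOn h (entryInterval X))
    {M : (Fin (r + 1) → ℝ) → ℝ} (hM : IsDirichletSpline d X M)
    {V : Set (Fin (r + 1) → ℂ)} {H : (Fin (r + 1) → ℂ) → (Fin (r + 1) → ℝ) → ℂ}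
    (hV : IsContinuationRegion V)
    (hH : ∀ x ∈ convexHull ℝ (range X),
      IsAnalyticContinuation V (fun b => dirichletAverage h b x) fun b => H b x)
    (hc : ContinuousOn (fun p : (Fin (r + 1) → ℂ) × (Fin (r + 1) → ℝ) => H p.1 p.2)
      (V ×ˢ convexHull ℝ (range X))) :
    IsAnalyticContinuation V (fun b => doubleDirichletAverage h b X d)
      fun b => ∫ x in convexHull ℝ (range X), (M x : ℂ) * H b x := by
  have hK := isCompact_convexHull_range X
  refine ⟨?_, fun b hb => ?_⟩
  · refine differentiableOn_integral_of_dominated hV.1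
      (fun b hb => (hM.integrableOn_mul (continuousOn_section hc hb)).aestronglyMeasurable) ?_ ?_
    · filter_upwards [ae_restrict_mem hK.measurableSet] with x hx
      exact (hH x hx).1.const_mul _
    · intro b₀ hb₀
      obtain ⟨ε, hε, hball⟩ := Metric.nhds_basis_closedBall.mem_iff.1 (hV.1.mem_nhds hb₀)
      obtain ⟨C, hC⟩ := ((isCompact_closedBall b₀ ε).prod hK).exists_bound_of_continuousOn
        (hc.mono (prod_mono_left hball))
      refine ⟨ε, hε, fun x => ‖M x‖ * C,
        (hM.1.integrableOn_isCompact hK).norm.mul_const C, ?_⟩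
      filter_upwards [ae_restrict_mem hK.measurableSet] with x hx b hb
      rw [norm_mul, Complex.norm_real]
      exact mul_le_mul_of_nonneg_left (hC (b, x) ⟨Metric.ball_subset_closedBall hb, hx⟩)
        (norm_nonneg _)
  · simp only [doubleDirichletAverage_eq_setIntegral hX hd hh hM hb]
    refine setIntegral_congr_fun hK.measurableSet fun x hx => ?_
    simp only [(hH x hx).2 b hb]

end Main

theorem theorem6p1 (r n : ℕ) (X : Fin (n + 1) → Fin (r + 1) → ℝ)
    (hX : 0 < volume (convexHull ℝ (range X)))
    (d : Fin (n + 1) → ℝ) (hd : ∀ j, 0 < d j)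
    (h : ℝ → ℂ) (hh : ContinuousOn h (entryInterval X)) :
    -- the Dirichlet spline exists
    (∃ M, IsDirichletSpline d X M) ∧
    ∀ M, IsDirichletSpline d X M →
      -- positive parameters
      (∀ b : Fin (r + 1) → ℝ, (∀ i, 0 < b i) →
        IntegrableOn (fun x => (M x : ℂ) * dirichletAverage h b x) (convexHull ℝ (range X)) ∧
        doubleDirichletAverage h b X d =
          ∫ x in convexHull ℝ (range X), (M x : ℂ) * dirichletAverage h b x) ∧
      -- continuous `h`: all regions to which the single averages continue, continuously in `x`
      (∀ (V : Set (Fin (r + 1) → ℂ)) (H : (Fin (r + 1) → ℂ) → (Fin (r + 1) → ℝ) → ℂ),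
        IsContinuationRegion V →
        (∀ x ∈ convexHull ℝ (range X),
          IsAnalyticContinuation V (fun b => dirichletAverage h b x) (fun b => H b x)) →
        ContinuousOn (fun p : (Fin (r + 1) → ℂ) × (Fin (r + 1) → ℝ) => H p.1 p.2)
          (V ×ˢ convexHull ℝ (range X)) →
        (∃ D, IsAnalyticContinuation V (fun b => doubleDirichletAverage h b X d) D) ∧
        ∀ D, IsAnalyticContinuation V (fun b => doubleDirichletAverage h b X d) D →
          ∀ b ∈ V,
            IntegrableOn (fun x => (M x : ℂ) * H b x) (convexHull ℝ (range X)) ∧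
            D b = ∫ x in convexHull ℝ (range X), (M x : ℂ) * H b x) ∧
      -- smooth `h`: the averages continue to all `b` with `c ≠ 0, -1, -2, …`
      (ContDiffOn ℝ ∞ h (entryInterval X) →
        (∀ x ∈ convexHull ℝ (range X), ∃ F,
          IsAnalyticContinuation (regularParams (r + 1)) (fun b => dirichletAverage h b x) F) ∧
        (∃ D, IsAnalyticContinuation (regularParams (r + 1))
          (fun b => doubleDirichletAverage h b X d) D) ∧
        ∀ (H : (Fin (r + 1) → ℂ) → (Fin (r + 1) → ℝ) → ℂ) (D : (Fin (r + 1) → ℂ) → ℂ),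
          (∀ x ∈ convexHull ℝ (range X),
            IsAnalyticContinuation (regularParams (r + 1))
              (fun b => dirichletAverage h b x) (fun b => H b x)) →
          IsAnalyticContinuation (regularParams (r + 1))
            (fun b => doubleDirichletAverage h b X d) D →
          ∀ b ∈ regularParams (r + 1),
            IntegrableOn (fun x => (M x : ℂ) * H b x) (convexHull ℝ (range X)) ∧
            D b = ∫ x in convexHull ℝ (range X), (M x : ℂ) * H b x) := by
  have hspline := isDirichletSpline_rnDeriv hX hd
  refine ⟨⟨_, hspline⟩, fun M hM => ?_⟩
  have hcont : ∀ (V : Set (Fin (r + 1) → ℂ)) (H : (Fin (r + 1) → ℂ) → (Fin (r + 1) → ℝ) → ℂ),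
      IsContinuationRegion V →
      (∀ x ∈ convexHull ℝ (range X),
        IsAnalyticContinuation V (fun b => dirichletAverage h b x) (fun b => H b x)) →
      ContinuousOn (fun p : (Fin (r + 1) → ℂ) × (Fin (r + 1) → ℝ) => H p.1 p.2)
        (V ×ˢ convexHull ℝ (range X)) →
      (∃ D, IsAnalyticContinuation V (fun b => doubleDirichletAverage h b X d) D) ∧
      ∀ D, IsAnalyticContinuation V (fun b => doubleDirichletAverage h b X d) D →
        ∀ b ∈ V,
          IntegrableOn (fun x => (M x : ℂ) * H b x) (convexHull ℝ (range X)) ∧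
          D b = ∫ x in convexHull ℝ (range X), (M x : ℂ) * H b x := by
    intro V H hV hH hc
    have hD₀ := isAnalyticContinuation_setIntegral hX hd hh hM hV hH hc
    exact ⟨⟨_, hD₀⟩, fun D hD b hb =>
      ⟨hM.integrableOn_mul (continuousOn_section hc hb), hD.eqOn hV hD₀ hb⟩⟩
  refine ⟨fun b hb => ⟨hM.integrableOn_mul (continuousOn_dirichletAverage hh hX hb),
    doubleDirichletAverage_eq_setIntegral hX hd hh hM hb⟩, hcont, fun hsmooth => ?_⟩
  have hV := isContinuationRegion_regularParams r
  have hsub := convexHull_range_subset_pi_Icc X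
  obtain ⟨H₀, hH₀, hc₀⟩ := exists_continuation_dirichletAverage (m := r)
    (iInf_lt_iSup_of_volume_pos hX) hsmooth
  have hc := hc₀.mono (prod_mono_right hsub)
  refine ⟨fun x hx => ⟨_, hH₀ x (hsub hx)⟩,
    (hcont _ H₀ hV (fun x hx => hH₀ x (hsub hx)) hc).1, fun H D hH hD => ?_⟩
  -- An arbitrary continuation H agrees with the constructed `H₀` by uniqueness and so inherits its
  -- joint continuity, which is not assumed here.
  refine (hcont _ H hV hH (hc.congr fun p hp => ?_)).2 D hD
  exact (hH p.2 hp.2).eqOn hV (hH₀ p.2 (hsub hp.2)) hp.1
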